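/- Let $d\ge 2$ and $q\ge1$ be integers. For $L>0$ let $C_L=[-L/2,L/2)^d$, let $-\Delta_L$ be the Laplacian with periodic boundary conditions on $L^2(C_L,\mathbb{C}^q)$, and for $\mu\ge0$ let $\Pi^-_{L,\mu}=\mathbf 1(-\Delta_L\le\mu)$. Put $$\delta\mathcal T^{\rm sc}_\mu(\rho)=(\rho_0+\rho)^{1+\frac2d}-\rho_0^{1+\frac2d}-\frac{d+2}{d}\,\rho_0^{\frac2d}\,\rho,\qquad \rho_0=\rho_0(\mu)=\mu^{d/2}\,\frac{q\,|S^{d-1}|}{(2\pi)^{d}\,d}.$$ Then there exist constants $\tilde K>0$ and $C>0$, depending only on $d$ and $q$, such that for all $\mu\ge0$, all $L>0$ and every self-adjoint operator $Q$ of finite rank on $L^2(C_L,\mathbb{C}^q)$ with $-\Pi^-_{L,\mu}\le Q\le 1-\Pi^-_{L,\mu}$ and density $\rho_Q(x)=\mathrm{tr}_{\mathbb{C}^q}Q(x,x)$, $$\mathrm{tr}_{L^2(C_L)}(-\Delta_L-\mu)Q\;\ge\;\tilde K\int_{C_L}\delta\mathcal T^{\rm sc}_\mu\Big(\big(|\rho_Q(x)|-C\,L^{-1}\mu^{\frac{d-1}{2}}\big)_+\Big)\,dx\qquad\text{if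 }\mu>1/L^2,$$ $$\mathrm{tr}_{L^2(C_L)}(-\Delta_L-\mu)Q\;\ge\;\tilde K\int_{C_L}\delta\mathcal T^{\rm sc}_0\Big(\big(|\rho_Q(x)|-C\,L^{-d}\big)_+\Big)\,dx\qquad\text{if }\mu\le1/L^2.$$ Here the trace is understood in $[0,+\infty]$, as $\mathrm{tr}\,|-\Delta_L-\mu|^{1/2}\big(Q^{++}-Q^{--}\big)|-\Delta_L-\mu|^{1/2}$ with $Q^{++}=(1-\Pi^-_{L,\mu})Q(1-\Pi^-_{L,\mu})\ge0$ and $Q^{--}=\Pi^-_{L,\mu}Q\Pi^-_{L,\mu}\le0$; in particular the integral is finite whenever the trace is. -/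

import Mathlib

open MeasureTheory

noncomputable section

namespace PeriodicBox

/-- The cube `C_L = [-L/2, L/2)^d`, as a subset of `ℝ^d` (with Lebesgue measure). -/
def cube (d : ℕ) (L : ℝ) : Set (Fin d → ℝ) :=
  Set.univ.pi fun _ => Set.Ico (-(L / 2)) (L / 2)

/-- Lebesgue measure on the cube. -/
abbrev cubeMeasure (d : ℕ) (L : ℝ) : Measure (Fin d → ℝ) :=
  (volume : Measure (Fin d → ℝ)).restrict (cube d L)

instance isFiniteMeasure_cubeMeasure (d : ℕ) (L : ℝ) : IsFiniteMeasure (cubeMeasure d L) := by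
  constructor
  rw [Measure.restrict_apply_univ, cube, Real.volume_pi_Ico]
  exact ENNReal.prod_lt_top fun i _ => ENNReal.ofReal_lt_top

/-- The Hilbert space `L²(C_L, ℂ^q)`. -/
abbrev BoxL2 (d q : ℕ) (L : ℝ) : Type :=
  Lp (EuclideanSpace ℂ (Fin q)) 2 (cubeMeasure d L)

/-- `|k|²` for the momentum `k = 2πn/L ∈ (2πℤ/L)^d`: the eigenvalues of the periodic
Laplacian `-Δ_L`. -/
def momentumSq {d : ℕ} (L : ℝ) (n : Fin d → ℤ) : ℝ :=
  ∑ i, (2 * Real.pi * (n i : ℝ) / L) ^ 2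

/-- The normalized plane wave `x ↦ L^{-d/2} e^{i k·x} ε_σ`, where `k = 2πn/L` and `ε_σ` is the
`σ`-th vector of the standard basis of `ℂ^q`. -/
def planeWaveFun {d q : ℕ} (L : ℝ) (n : Fin d → ℤ) (σ : Fin q) (x : Fin d → ℝ) :
    EuclideanSpace ℂ (Fin q) :=
  ((((Real.sqrt (L ^ d))⁻¹ : ℝ) : ℂ) *
      Complex.exp (((∑ i, (2 * Real.pi * (n i : ℝ) / L) * x i : ℝ) : ℂ) * Complex.I)) •
    EuclideanSpace.single σ (1 : ℂ)

theorem continuous_planeWaveFun {d q : ℕ} (L : ℝ) (n : Fin d → ℤ) (σ : Fin q) :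
    Continuous (planeWaveFun L n σ) := by
  unfold planeWaveFun
  fun_prop

theorem norm_planeWaveFun {d q : ℕ} (L : ℝ) (n : Fin d → ℤ) (σ : Fin q) (x : Fin d → ℝ) :
    ‖planeWaveFun L n σ x‖ = (Real.sqrt (L ^ d))⁻¹ := by
  rw [planeWaveFun, norm_smul, norm_mul, Complex.norm_exp_ofReal_mul_I, Complex.norm_real]
  simp [abs_of_nonneg (Real.sqrt_nonneg _)]

theorem memLp_planeWaveFun {d q : ℕ} (L : ℝ) (n : Fin d → ℤ) (σ : Fin q) :
    MemLp (planeWaveFun L n σ) 2 (cubeMeasure d L) :=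
  MemLp.of_bound (continuous_planeWaveFun L n σ).aestronglyMeasurable _
    (Filter.Eventually.of_forall fun x => (norm_planeWaveFun L n σ x).le)

/-- For `L ≠ 0` the plane waves are `L`-periodic in every coordinate. -/
theorem planeWaveFun_periodic {d q : ℕ} {L : ℝ} (hL : L ≠ 0) (n : Fin d → ℤ) (σ : Fin q)
    (x : Fin d → ℝ) (j : Fin d) :
    planeWaveFun L n σ (x + Pi.single j L) = planeWaveFun L n σ x := by
  unfold planeWaveFun
  congr 2
  rw [Complex.exp_eq_exp_iff_exists_int]
  refine ⟨n j, ?_⟩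
  have h : (∑ i, (2 * Real.pi * (n i : ℝ) / L) * ((x + Pi.single j L : Fin d → ℝ) i) : ℝ)
      = (∑ i, (2 * Real.pi * (n i : ℝ) / L) * x i : ℝ) + 2 * Real.pi * (n j : ℝ) := by
    simp only [Pi.add_apply, mul_add, Finset.sum_add_distrib]
    congr 1
    rw [Finset.sum_eq_single j]
    · simp
      field_simp
    · intro b _ hb
      simp [Pi.single_eq_of_ne hb]
    · simp
  rw [h]
  push_cast
  ring

/-- The partial derivative of a plane wave in the `j`-th coordinate is `i k_j` times the plane
wave. Applied twice and summed over `j`, this says that a plane wave is an eigenfunction of `-Δ`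
with eigenvalue `|k|²`. -/
theorem hasDerivAt_planeWaveFun {d q : ℕ} (L : ℝ) (n : Fin d → ℤ) (σ : Fin q)
    (x : Fin d → ℝ) (j : Fin d) (t : ℝ) :
    HasDerivAt (fun s : ℝ => planeWaveFun L n σ (Function.update x j s))
      ((((2 * Real.pi * (n j : ℝ) / L : ℝ) : ℂ) * Complex.I) •
        planeWaveFun L n σ (Function.update x j t)) t := by
  set a : Fin d → ℝ := fun i => 2 * Real.pi * (n i : ℝ) / L with ha
  have h1 : ∀ s : ℝ, ∑ i, a i * Function.update x j s i
      = a j * s + ∑ i ∈ Finset.univ.erase j, a i * x i := by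
    intro s
    rw [← Finset.add_sum_erase _ _ (Finset.mem_univ j), Function.update_self]
    congr 1
    refine Finset.sum_congr rfl fun i hi => ?_
    rw [Function.update_of_ne (Finset.ne_of_mem_erase hi)]
  have h2 : HasDerivAt (fun s : ℝ => ∑ i, a i * Function.update x j s i) (a j) t := by
    simp only [h1]
    simpa using ((hasDerivAt_id t).const_mul (a j)).add_const
      (∑ i ∈ Finset.univ.erase j, a i * x i)
  have h3 := (((h2.ofReal_comp.mul_const Complex.I).cexp).const_mul
    (((Real.sqrt (L ^ d))⁻¹ : ℝ) : ℂ)).smul_const (EuclideanSpace.single σ (1 : ℂ))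
  refine HasDerivAt.congr_deriv h3 ?_
  unfold planeWaveFun
  rw [smul_smul]
  congr 1
  simp only [ha]
  ring

/-- The plane waves as elements of `L²(C_L, ℂ^q)`. They form an orthonormal basis of
eigenfunctions of the periodic Laplacian `-Δ_L`. -/
def planeWave {d q : ℕ} (L : ℝ) (n : Fin d → ℤ) (σ : Fin q) : BoxL2 d q L :=
  (memLp_planeWaveFun L n σ).toLp (planeWaveFun L n σ)

/-- The range of the spectral projection `1(-Δ_L ≤ μ)`: the (closed) span of the plane waves
with `|k|² ≤ μ`. -/
def fermiSpace (d q : ℕ) (L μ : ℝ) : Submodule ℂ (BoxL2 d q L) :=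
  (Submodule.span ℂ
    {f | ∃ (n : Fin d → ℤ) (σ : Fin q), momentumSq L n ≤ μ ∧ f = planeWave L n σ}).topologicalClosure

instance completeSpace_fermiSpace (d q : ℕ) (L μ : ℝ) : CompleteSpace (fermiSpace d q L μ) :=
  (Submodule.isClosed_topologicalClosure _).completeSpace_coe

/-- The spectral projection `Π⁻_{L,μ} = 1(-Δ_L ≤ μ)` on `L²(C_L, ℂ^q)`. -/
def fermiProj (d q : ℕ) (L μ : ℝ) : BoxL2 d q L →L[ℂ] BoxL2 d q L :=
  (fermiSpace d q L μ).starProjection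

/-- The trace `tr (-Δ_L - μ)Q`, computed in the orthonormal eigenbasis of `-Δ_L`, i.e. the sum of
the numbers `⟨(-Δ_L - μ)e, Q e⟩ = (|k|² - μ)⟨e, Q e⟩` over the plane waves `e`, as an extended
real number (sum of the positive terms minus sum of the negative terms).
If `-Π⁻ ≤ Q ≤ 1 - Π⁻`, no term is negative, and the trace is
`tr |-Δ_L - μ|^{1/2} (Π⁺QΠ⁺ - Π⁻QΠ⁻) |-Δ_L - μ|^{1/2} ∈ [0, +∞]`. -/
def kineticTrace {d q : ℕ} {L : ℝ} (μ : ℝ) (Q : BoxL2 d q L →L[ℂ] BoxL2 d q L) : EReal :=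
  ((∑' p : (Fin d → ℤ) × Fin q, ENNReal.ofReal
      ((momentumSq L p.1 - μ) * (inner ℂ (planeWave L p.1 p.2) (Q (planeWave L p.1 p.2))).re) :
        ENNReal) : EReal) -
  ((∑' p : (Fin d → ℤ) × Fin q, ENNReal.ofReal
      (-((momentumSq L p.1 - μ) * (inner ℂ (planeWave L p.1 p.2) (Q (planeWave L p.1 p.2))).re)) :
        ENNReal) : EReal)

/-- The density `ρ_Q(x) = tr_{ℂ^q} Q(x,x)` of a self-adjoint operator of finite rank. With an
orthonormal basis `(b_i)` of the range of `Q` one has `Q = ∑ |Q b_i⟩⟨b_i|`, hence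
`ρ_Q(x) = ∑ ⟨b_i(x), (Q b_i)(x)⟩`; almost everywhere this does not depend on the basis. -/
def density {d q : ℕ} {L : ℝ} (Q : BoxL2 d q L →L[ℂ] BoxL2 d q L)
    [FiniteDimensional ℂ (LinearMap.range (Q : BoxL2 d q L →ₗ[ℂ] BoxL2 d q L))]
    (x : Fin d → ℝ) : ℝ :=
  let b := stdOrthonormalBasis ℂ (LinearMap.range (Q : BoxL2 d q L →ₗ[ℂ] BoxL2 d q L))
  ∑ i, (inner ℂ ((b i : BoxL2 d q L) x) ((Q (b i : BoxL2 d q L)) x)).re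

/-- The surface area `|S^{d-1}|` of the unit sphere of `ℝ^d`. -/
def sphereArea (d : ℕ) : ℝ :=
  (volume : Measure (EuclideanSpace ℝ (Fin d))).toSphere.real Set.univ

/-- The density `ρ₀ = μ^{d/2} q (2π)^{-d} |S^{d-1}| / d` of the free Fermi gas. -/
def fermiDensity (d q : ℕ) (μ : ℝ) : ℝ :=
  μ ^ ((d : ℝ) / 2) * q * ((2 * Real.pi) ^ d)⁻¹ * sphereArea d / d

/-- The semi-classical energy variation
`δT_μ(ρ) = (ρ₀ + ρ)^{1+2/d} - ρ₀^{1+2/d} - ((d+2)/d) ρ₀^{2/d} ρ`. -/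
def deltaT (d q : ℕ) (μ ρ : ℝ) : ℝ :=
  (fermiDensity d q μ + ρ) ^ (1 + 2 / (d : ℝ)) - fermiDensity d q μ ^ (1 + 2 / (d : ℝ))
    - ((d : ℝ) + 2) / d * fermiDensity d q μ ^ (2 / (d : ℝ)) * ρ

end PeriodicBox

end

/-!
The operator `γ = Q + Π⁻` satisfies `0 ≤ γ ≤ 1`, and the trace is the sum of the nonnegative numbers
`(|k|² - μ) ⟨e, Q e⟩` over the plane waves `e`. In units in which the box has volume one and momenta
are integer vectors, with `R` the Fermi momentum (at least `1`), the semi-classical energy variation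
is bounded by a constant times `min (ρ² / R^(d-2)) ρ^(1 + 2/d)`, the `energyProfile`. So the density
of `Q` has to be bounded in terms of this profile, up to an error of order `R^(d-1)`. For finitely
many modes, `Q` is split according to whether the modes lie inside or outside the Fermi surface.

* The diagonal parts, `1 - γ` inside and `γ` outside, are treated by Rumin's method
  (`lintegral_density_mul_le`): the energy is the integral over `T` of the mass in modes at energy
  distance more than `T` from the Fermi surface, and the other modes contribute to the density at
  most `q` times their number, which is counted by comparison with the volume of an
  annulus (`card_shell_le`).
  A shell always contains up to `O(R^(d-1))` lattice points, which is one source of the error.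
* For the off-diagonal part `∑ ⟨e_n, γ e_m⟩ e^{i(n-m)x}`, Parseval's identity and the Cauchy-Schwarz
  inequality with weights `|m|² - |n|²` give an `L²` bound (`integral_norm_localDensity_sq_le`),
  because `γ² ≤ γ` and `(1 - γ)² ≤ 1 - γ` bound the weighted Hilbert-Schmidt norm by the energy
  (`sum_norm_inner_sq_le_energy`). The sum of the inverse weights at fixed `k = n - m` is compared
  with an integral, and this integral is `O(R^(d-2))` in dimension `d ≥ 2`: the denominator is
  constant on slices orthogonal to `k`, and each slice is an annulus whose volume is proportional
  to the denominator (`lintegral_lindhard_le`).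
* The remaining modes, within `O(R)` of the Fermi surface in energy, are `O(R^(d-1))` in number.
  They are the other source of the error.

The three parts are combined in `lintegral_energyProfile_density_le`. All constants are independent
of the set of modes. Since the plane waves are a Hilbert basis, the truncated densities converge to
the density of `Q` almost everywhere along a sequence, and Fatou's lemma gives the inequality for
`Q` (`PeriodicBox.lintegral_energyProfile_le_kineticTrace`).
-/

noncomputable section

/-! ### A Lindhard-type integral -/

theorem lintegral_inv_sqrt_sq_sub_sq {r : ℝ} (hr : 0 < r) :
    ∫⁻ s in Set.Ioo (-r) r, ENNReal.ofReal (1 / √(r ^ 2 - s ^ 2)) = ENNReal.ofReal Real.pi := by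
  have hd : ∀ s ∈ Set.Ioo (-r) r,
      HasDerivAt (fun s => Real.arcsin (s / r)) (1 / √(r ^ 2 - s ^ 2)) s := by
    intro s hs
    have h1 : s / r ≠ -1 := by
      rw [Ne, div_eq_iff hr.ne']; linarith [hs.1]
    have h2 : s / r ≠ 1 := by
      rw [Ne, div_eq_iff hr.ne']; linarith [hs.2]
    have h := (Real.hasDerivAt_arcsin h1 h2).comp s ((hasDerivAt_id s).div_const r)
    refine h.congr_deriv ?_
    have h3 : 1 - (s / r) ^ 2 = (r ^ 2 - s ^ 2) / r ^ 2 := by field_simp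
    rw [h3, Real.sqrt_div' _ (sq_nonneg r), Real.sqrt_sq hr.le]
    have h4 : 0 < √(r ^ 2 - s ^ 2) := Real.sqrt_pos.2 (by nlinarith [hs.1, hs.2])
    field_simp
  have hc : ContinuousOn (fun s => Real.arcsin (s / r)) (Set.Icc (-r) r) :=
    (Real.continuous_arcsin.comp (continuous_id.div_const r)).continuousOn
  have hpos : ∀ s ∈ Set.Ioo (-r) r, 0 ≤ 1 / √(r ^ 2 - s ^ 2) := fun s _ => by positivity
  have hi : IntegrableOn (fun s => 1 / √(r ^ 2 - s ^ 2)) (Set.Ioc (-r) r) :=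
    intervalIntegral.integrableOn_deriv_of_nonneg hc hd hpos
  have hle : -r ≤ r := by linarith
  have he := intervalIntegral.integral_eq_sub_of_hasDerivAt_of_le hle hc hd
    ((intervalIntegrable_iff_integrableOn_Ioc_of_le hle).2 hi)
  rw [← ofReal_integral_eq_lintegral_ofReal (hi.mono_set Set.Ioo_subset_Ioc_self)
    (Filter.Eventually.of_forall fun s => by positivity), ← integral_Ioc_eq_integral_Ioo,
    ← intervalIntegral.integral_of_le hle, he]
  congr 1
  rw [div_self hr.ne', neg_div, div_self hr.ne', Real.arcsin_one, Real.arcsin_neg, Real.arcsin_one]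
  ring

/-- The volume of the unit ball of `ℝ^n`, for `n ≥ 1`. -/
def ballVolume (n : ℕ) : ℝ := √Real.pi ^ n / Real.Gamma (n / 2 + 1)

theorem ballVolume_pos (n : ℕ) : 0 < ballVolume n := by
  unfold ballVolume
  have : 0 < Real.Gamma ((n : ℝ) / 2 + 1) := Real.Gamma_pos_of_pos (by positivity)
  have := Real.pi_pos
  positivity

theorem measurableSet_lt_and_lt {α : Type*} [MeasurableSpace α] {f g : α → ℝ}
    (hf : Measurable f) (hg : Measurable g) (c : ℝ) : MeasurableSet {x | f x < c ∧ c < g x} :=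
  (measurableSet_lt hf measurable_const).inter (measurableSet_lt measurable_const hg)

section Geometry

variable {E : Type*} [NormedAddCommGroup E] [InnerProductSpace ℝ E] [FiniteDimensional ℝ E]
  [MeasurableSpace E] [BorelSpace E]

theorem volume_ball_eq_ballVolume [Nontrivial E] {a : ℝ} (ha : 0 ≤ a) (x : E) :
    volume (Metric.ball x a) =
      ENNReal.ofReal (ballVolume (Module.finrank ℝ E) * a ^ Module.finrank ℝ E) := by
  rw [InnerProductSpace.volume_ball, ENNReal.ofReal_mul (ballVolume_pos _).le, mul_comm,
    ENNReal.ofReal_pow ha]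
  rfl

theorem volume_ball_sdiff_ball [Nontrivial E] {a b : ℝ} (hb : 0 ≤ b) (hab : b ≤ a) :
    volume (Metric.ball (0 : E) a \ Metric.ball 0 b) =
      ENNReal.ofReal (ballVolume (Module.finrank ℝ E) *
        (a ^ Module.finrank ℝ E - b ^ Module.finrank ℝ E)) := by
  rw [measure_sdiff (Metric.ball_subset_ball hab) measurableSet_ball.nullMeasurableSet
    measure_ball_lt_top.ne, volume_ball_eq_ballVolume (hb.trans hab), volume_ball_eq_ballVolume hb,
    ← ENNReal.ofReal_sub _ (mul_nonneg (ballVolume_pos _).le (by positivity)), mul_sub]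

theorem pow_sub_pow_le_mul_pow {a b : ℝ} (hb : 0 ≤ b) (hab : b ≤ a) (n : ℕ) :
    a ^ n - b ^ n ≤ n * a ^ (n - 1) * (a - b) := by
  have h := (le_abs_self _).trans (abs_pow_sub_pow_le a b n)
  rw [abs_of_nonneg (sub_nonneg.2 hab), abs_of_nonneg (hb.trans hab), abs_of_nonneg hb,
    max_eq_left hab] at h
  linarith

/-- Splitting off the direction of a unit vector preserves Lebesgue measure. -/
theorem measurePreserving_smul_add_orthogonal {e : E} (he : ‖e‖ = 1) :
    MeasurePreserving (fun p : ℝ × (ℝ ∙ e)ᗮ => p.1 • e + (p.2 : E)) := by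
  have h1 : MeasurePreserving (Prod.map (LinearIsometryEquiv.toSpanUnitSingleton (𝕜 := ℝ) e he)
      (id : (ℝ ∙ e)ᗮ → (ℝ ∙ e)ᗮ)) :=
    (LinearIsometryEquiv.measurePreserving _).prod (MeasurePreserving.id _)
  have h2 := WithLp.volume_preserving_toLp (ℝ ∙ e) (ℝ ∙ e)ᗮ
  have h3 := ((ℝ ∙ e).orthogonalDecomposition.symm).measurePreserving
  have h := h3.comp (h2.comp h1)
  convert h using 1
  ext p
  simp

omit [FiniteDimensional ℝ E] [MeasurableSpace E] [BorelSpace E] in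
theorem norm_smul_add_orthogonal_sq {e : E} (he : ‖e‖ = 1) (s : ℝ) (w : (ℝ ∙ e)ᗮ) :
    ‖s • e + (w : E)‖ ^ 2 = s ^ 2 + ‖w‖ ^ 2 := by
  have h : inner ℝ (s • e) (w : E) = 0 :=
    Submodule.inner_right_of_mem_orthogonal
      (Submodule.smul_mem _ s (Submodule.mem_span_singleton_self e)) w.2
  rw [norm_add_sq_real, h, norm_smul, he]
  simp

/-- The slice estimate behind the Lindhard bound. -/
theorem volume_slice_mul_inv_le {n : ℕ} [Nontrivial E] (hn : Module.finrank ℝ E = n)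
    {r : ℝ} (hr : 0 < r) {κ s : ℝ} (hs : s ∈ Set.Ioo (-r) r) :
    ENNReal.ofReal (1 / ((s - κ) ^ 2 - s ^ 2)) *
        volume {w : E | s ^ 2 + ‖w‖ ^ 2 < r ^ 2 ∧ r ^ 2 < (s - κ) ^ 2 + ‖w‖ ^ 2} ≤
      ENNReal.ofReal (ballVolume n * n * r ^ (n - 1)) *
        ENNReal.ofReal (1 / √(r ^ 2 - s ^ 2)) := by
  set D := (s - κ) ^ 2 - s ^ 2 with hD
  rcases le_or_gt D 0 with h0 | h0
  · have : ENNReal.ofReal (1 / D) = 0 := ENNReal.ofReal_of_nonpos (one_div_nonpos.2 h0)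
    rw [this, zero_mul]
    exact zero_le
  have hA : 0 < r ^ 2 - s ^ 2 := by nlinarith [hs.1, hs.2]
  set a := √(r ^ 2 - s ^ 2) with ha
  set b := √(r ^ 2 - (s - κ) ^ 2) with hb
  have ha0 : 0 < a := Real.sqrt_pos.2 hA
  have ha2 : a ^ 2 = r ^ 2 - s ^ 2 := Real.sq_sqrt hA.le
  have hb0 : 0 ≤ b := Real.sqrt_nonneg _
  have hba : b ≤ a := Real.sqrt_le_sqrt (by linarith)
  have har : a ≤ r := by
    rw [ha, Real.sqrt_le_left hr.le]; nlinarith [sq_nonneg s]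
  have hb2 : r ^ 2 - (s - κ) ^ 2 ≤ b ^ 2 := by
    rcases le_or_gt 0 (r ^ 2 - (s - κ) ^ 2) with h | h
    · exact (Real.sq_sqrt h).ge
    · nlinarith [sq_nonneg b]
  have hsub : {w : E | s ^ 2 + ‖w‖ ^ 2 < r ^ 2 ∧ r ^ 2 < (s - κ) ^ 2 + ‖w‖ ^ 2} ⊆
      Metric.ball (0 : E) a \ Metric.ball 0 b := by
    rintro w ⟨h1, h2⟩
    simp only [Set.mem_sdiff, mem_ball_zero_iff, not_lt]
    constructor
    · exact Real.lt_sqrt_of_sq_lt (by linarith)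
    · rw [hb, Real.sqrt_le_left (norm_nonneg w)]; linarith
  calc _ ≤ ENNReal.ofReal (1 / D) * ENNReal.ofReal (ballVolume n * (a ^ n - b ^ n)) := by
        gcongr
        refine (measure_mono hsub).trans_eq ?_
        rw [volume_ball_sdiff_ball hb0 hba, hn]
    _ = ENNReal.ofReal (1 / D * (ballVolume n * (a ^ n - b ^ n))) := by
        rw [ENNReal.ofReal_mul (one_div_nonneg.2 h0.le)]
    _ ≤ ENNReal.ofReal (ballVolume n * n * r ^ (n - 1) * (1 / a)) := by
        apply ENNReal.ofReal_le_ofReal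
        have hω := ballVolume_pos n
        have h1 := pow_sub_pow_le_mul_pow hb0 hba n
        have h2 : (a - b) ≤ D / a := by
          rw [le_div_iff₀ ha0]; nlinarith
        have h3 : a ^ (n - 1) ≤ r ^ (n - 1) := pow_le_pow_left₀ ha0.le har _
        have h4 : a ^ n - b ^ n ≤ n * r ^ (n - 1) * (D / a) := by
          refine h1.trans ?_
          have : 0 ≤ a - b := sub_nonneg.2 hba
          gcongr
        calc 1 / D * (ballVolume n * (a ^ n - b ^ n))
            ≤ 1 / D * (ballVolume n * (n * r ^ (n - 1) * (D / a))) := by gcongr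
          _ = _ := by field_simp
    _ = _ := by
        have := (ballVolume_pos n).le
        rw [ENNReal.ofReal_mul (by positivity)]

/-- The Lindhard-type integral over the points of a ball whose translate by `-k` leaves the ball is
bounded uniformly in `k` by `r^(d-2)`. Slicing orthogonally to `k`, the slices are annuli whose
volume is controlled by the denominator, which is constant on slices. -/
theorem lintegral_lindhard_le {d : ℕ} (hd : 2 ≤ d) (hE : Module.finrank ℝ E = d)
    {r : ℝ} (hr : 0 < r) (k : E) :
    ∫⁻ y in {y : E | ‖y‖ ^ 2 < r ^ 2 ∧ r ^ 2 < ‖y - k‖ ^ 2},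
        ENNReal.ofReal (1 / (‖y - k‖ ^ 2 - ‖y‖ ^ 2)) ≤
      ENNReal.ofReal (ballVolume (d - 1) * (d - 1 : ℕ) * r ^ (d - 2) * Real.pi) := by
  rcases eq_or_ne k 0 with rfl | hk
  · have : {y : E | ‖y‖ ^ 2 < r ^ 2 ∧ r ^ 2 < ‖y - 0‖ ^ 2} = ∅ := by
      ext y
      simp only [sub_zero, Set.mem_ofPred_eq, Set.mem_empty_iff_false, iff_false, not_and, not_lt]
      exact fun h => h.le
    rw [this, Measure.restrict_empty, lintegral_zero_measure]
    exact zero_le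
  set κ := ‖k‖ with hκd
  have hκ : 0 < κ := norm_pos_iff.2 hk
  set e : E := κ⁻¹ • k with hed
  have he : ‖e‖ = 1 := by
    rw [hed, norm_smul, norm_inv, Real.norm_of_nonneg hκ.le, ← hκd, inv_mul_cancel₀ hκ.ne']
  have hke : k = κ • e := by rw [hed, smul_smul, mul_inv_cancel₀ hκ.ne', one_smul]
  have hfin : Module.finrank ℝ (ℝ ∙ e)ᗮ = d - 1 := by
    have h1 := (ℝ ∙ e).finrank_add_finrank_orthogonal
    rw [finrank_span_singleton (norm_ne_zero_iff.1 (by rw [he]; exact one_ne_zero)), hE] at h1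
    omega
  have hnt : Nontrivial (ℝ ∙ e)ᗮ := Module.nontrivial_of_finrank_pos (R := ℝ) (by omega)
  have hmp := measurePreserving_smul_add_orthogonal he
  have hS : MeasurableSet {y : E | ‖y‖ ^ 2 < r ^ 2 ∧ r ^ 2 < ‖y - k‖ ^ 2} :=
    measurableSet_lt_and_lt (by fun_prop) (by fun_prop) _
  set F : E → ENNReal := Set.indicator {y : E | ‖y‖ ^ 2 < r ^ 2 ∧ r ^ 2 < ‖y - k‖ ^ 2}
    (fun y => ENNReal.ofReal (1 / (‖y - k‖ ^ 2 - ‖y‖ ^ 2))) with hF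
  have hFm : Measurable F := Measurable.indicator (by fun_prop) hS
  have hFc : Measurable fun p : ℝ × (ℝ ∙ e)ᗮ => F (p.1 • e + (p.2 : E)) := hFm.comp hmp.measurable
  rw [← lintegral_indicator hS, ← hF, ← hmp.lintegral_comp hFm, Measure.volume_eq_prod,
    lintegral_prod _ hFc.aemeasurable]
  have hn1 : ∀ (s : ℝ) (w : (ℝ ∙ e)ᗮ), ‖s • e + (w : E)‖ ^ 2 = s ^ 2 + ‖w‖ ^ 2 :=
    norm_smul_add_orthogonal_sq he
  have hn2 : ∀ (s : ℝ) (w : (ℝ ∙ e)ᗮ), ‖s • e + (w : E) - k‖ ^ 2 = (s - κ) ^ 2 + ‖w‖ ^ 2 := by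
    intro s w
    rw [← norm_smul_add_orthogonal_sq he (s - κ) w, hke]
    congr 2
    module
  have hslice : ∀ s : ℝ, ∫⁻ w : (ℝ ∙ e)ᗮ, F (s • e + (w : E)) =
      ENNReal.ofReal (1 / ((s - κ) ^ 2 - s ^ 2)) *
        volume {w : (ℝ ∙ e)ᗮ | s ^ 2 + ‖w‖ ^ 2 < r ^ 2 ∧ r ^ 2 < (s - κ) ^ 2 + ‖w‖ ^ 2} := by
    intro s
    have hm : MeasurableSet
        {w : (ℝ ∙ e)ᗮ | s ^ 2 + ‖w‖ ^ 2 < r ^ 2 ∧ r ^ 2 < (s - κ) ^ 2 + ‖w‖ ^ 2} :=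
      measurableSet_lt_and_lt (by fun_prop) (by fun_prop) _
    rw [← lintegral_indicator_const hm]
    congr 1
    ext w
    simp only [hF, Set.indicator, Set.mem_ofPred_eq, hn1, hn2, add_sub_add_right_eq_sub]
  calc ∫⁻ s : ℝ, ∫⁻ w : (ℝ ∙ e)ᗮ, F (s • e + (w : E))
      ≤ ∫⁻ s : ℝ, Set.indicator (Set.Ioo (-r) r) (fun s =>
          ENNReal.ofReal (ballVolume (d - 1) * (d - 1 : ℕ) * r ^ (d - 1 - 1)) *
            ENNReal.ofReal (1 / √(r ^ 2 - s ^ 2))) s := by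
        refine lintegral_mono fun s => ?_
        simp only [hslice]
        by_cases hs : s ∈ Set.Ioo (-r) r
        · rw [Set.indicator_of_mem hs]
          exact volume_slice_mul_inv_le hfin hr hs
        · have hempty : {w : (ℝ ∙ e)ᗮ | s ^ 2 + ‖w‖ ^ 2 < r ^ 2 ∧
              r ^ 2 < (s - κ) ^ 2 + ‖w‖ ^ 2} = ∅ := by
            ext w
            simp only [Set.mem_ofPred_eq, Set.mem_empty_iff_false, iff_false, not_and]
            intro h
            exact absurd (abs_lt.1 (abs_lt_of_sq_lt_sq (by nlinarith [sq_nonneg ‖w‖]) hr.le)) hs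
          rw [hempty]
          simp
    _ = _ := by
        rw [lintegral_indicator measurableSet_Ioo, lintegral_const_mul' _ _ ENNReal.ofReal_ne_top,
          lintegral_inv_sqrt_sq_sub_sq hr, ← ENNReal.ofReal_mul]
        · rfl
        · have := ballVolume_pos (d - 1)
          positivity

end Geometry

/-! ### Counting lattice points -/

/-- The lattice `ℤ^d` as a subset of Euclidean space. -/
def latticePoint {d : ℕ} (n : Fin d → ℤ) : EuclideanSpace ℝ (Fin d) :=
  WithLp.toLp 2 fun i => (n i : ℝ)

theorem latticePoint_sub {d : ℕ} (n k : Fin d → ℤ) :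
    latticePoint (n - k) = latticePoint n - latticePoint k := by
  ext i
  simp [latticePoint]

theorem norm_latticePoint_sq {d : ℕ} (n : Fin d → ℤ) :
    ‖latticePoint n‖ ^ 2 = ∑ i, (n i : ℝ) ^ 2 := by
  rw [EuclideanSpace.norm_sq_eq]
  simp [latticePoint]

/-- The half-open unit cube with lower corner `n`. -/
def latticeCell {d : ℕ} (n : Fin d → ℤ) : Set (EuclideanSpace ℝ (Fin d)) :=
  (MeasurableEquiv.toLp 2 (Fin d → ℝ)).symm ⁻¹'
    Set.univ.pi fun i => Set.Ico (n i : ℝ) (n i + 1)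

theorem measurableSet_latticeCell {d : ℕ} (n : Fin d → ℤ) : MeasurableSet (latticeCell n) :=
  (MeasurableEquiv.measurable _) (MeasurableSet.univ_pi fun _ => measurableSet_Ico)

theorem volume_latticeCell {d : ℕ} (n : Fin d → ℤ) : volume (latticeCell n) = 1 := by
  rw [latticeCell, (EuclideanSpace.volume_preserving_symm_measurableEquiv_toLp
    (Fin d)).measure_preimage_equiv, Real.volume_pi_Ico]
  simp

theorem mem_latticeCell {d : ℕ} {n : Fin d → ℤ} {y : EuclideanSpace ℝ (Fin d)} :
    y ∈ latticeCell n ↔ ∀ i, (n i : ℝ) ≤ y i ∧ y i < n i + 1 := by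
  simp [latticeCell]

theorem disjoint_latticeCell {d : ℕ} {n m : Fin d → ℤ} (h : n ≠ m) :
    Disjoint (latticeCell n) (latticeCell m) := by
  rw [Set.disjoint_left]
  intro y hy hy'
  rw [mem_latticeCell] at hy hy'
  refine h (funext fun i => ?_)
  rw [← Int.floor_eq_iff.2 (hy i), ← Int.floor_eq_iff.2 (hy' i)]

theorem norm_sub_latticePoint_le {d : ℕ} {n : Fin d → ℤ} {y : EuclideanSpace ℝ (Fin d)}
    (hy : y ∈ latticeCell n) : ‖y - latticePoint n‖ ≤ d := by
  rw [mem_latticeCell] at hy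
  refine abs_le_of_sq_le_sq' ?_ (Nat.cast_nonneg d) |>.2
  rw [EuclideanSpace.norm_sq_eq]
  calc ∑ i, ‖(y - latticePoint n) i‖ ^ 2 ≤ ∑ _i : Fin d, (1 : ℝ) := by
        refine Finset.sum_le_sum fun i _ => ?_
        have h1 : (y - latticePoint n) i = y i - n i := by simp [latticePoint]
        rw [h1, Real.norm_eq_abs, sq_abs]
        nlinarith [(hy i).1, (hy i).2]
    _ = d := by simp
    _ ≤ (d : ℝ) ^ 2 := by exact_mod_cast Nat.le_self_pow two_ne_zero d

/-- A sum over lattice points is at most an integral of a function dominating it on the cells. -/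
theorem sum_le_lintegral_of_latticeCell {d : ℕ} (G : Finset (Fin d → ℤ))
    (f : (Fin d → ℤ) → ENNReal) (g : EuclideanSpace ℝ (Fin d) → ENNReal)
    {S : Set (EuclideanSpace ℝ (Fin d))} (hS : ∀ n ∈ G, latticeCell n ⊆ S)
    (hfg : ∀ n ∈ G, ∀ y ∈ latticeCell n, f n ≤ g y) :
    ∑ n ∈ G, f n ≤ ∫⁻ y in S, g y := by
  calc ∑ n ∈ G, f n = ∑ n ∈ G, ∫⁻ _ in latticeCell n, f n := by
        simp [volume_latticeCell]
    _ ≤ ∑ n ∈ G, ∫⁻ y in latticeCell n, g y := by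
        refine Finset.sum_le_sum fun n hn => ?_
        exact setLIntegral_mono' (measurableSet_latticeCell n) (hfg n hn)
    _ = ∫⁻ y in ⋃ n ∈ G, latticeCell n, g y := by
        rw [lintegral_biUnion_finset]
        · exact fun n _ m _ h => disjoint_latticeCell h
        · exact fun n _ => measurableSet_latticeCell n
    _ ≤ _ := lintegral_mono_set (Set.iUnion₂_subset hS)

/-- The lattice version of the Lindhard bound. The points within distance of order `1` of the
sphere of radius `r` are excluded, so that the lattice sum is comparable with the integral. -/
theorem sum_lindhard_le {d : ℕ} (hd : 2 ≤ d) {r : ℝ} (hr : 1 ≤ r) (k : Fin d → ℤ)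
    (G : Finset (Fin d → ℤ))
    (h1 : ∀ n ∈ G, ‖latticePoint n‖ ^ 2 + 8 * d ^ 2 * r < r ^ 2)
    (h2 : ∀ n ∈ G, r ^ 2 + 8 * d ^ 2 * r < ‖latticePoint (n - k)‖ ^ 2) :
    ∑ n ∈ G, 1 / (‖latticePoint (n - k)‖ ^ 2 - ‖latticePoint n‖ ^ 2) ≤
      2 * (ballVolume (d - 1) * (d - 1 : ℕ) * r ^ (d - 2) * Real.pi) := by
  have hd' : (2 : ℝ) ≤ d := by exact_mod_cast hd
  have hr0 : 0 < r := by linarith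
  have hω := ballVolume_pos (d - 1)
  have hπ := Real.pi_pos
  have hkey : ∀ n ∈ G, ∀ y ∈ latticeCell n,
      (‖y‖ ^ 2 < r ^ 2 ∧ r ^ 2 < ‖y - latticePoint k‖ ^ 2) ∧
      ‖y - latticePoint k‖ ^ 2 - ‖y‖ ^ 2 ≤
        2 * (‖latticePoint (n - k)‖ ^ 2 - ‖latticePoint n‖ ^ 2) := by
    intro n hn y hy
    have g1 := h1 n hn
    have g2 := h2 n hn
    have hy' := norm_sub_latticePoint_le hy
    rw [latticePoint_sub] at *
    -- The excluded shells leave `y` and `y - k` on the same sides of the sphere as `n` and `n - k`,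
    -- and the denominator, which is affine in `n`, changes by at most a factor of two.
    set p := latticePoint n
    set K := latticePoint k
    have hp0 := norm_nonneg p
    have ha0 := norm_nonneg (p - K)
    have hpr : ‖p‖ < r := by
      refine lt_of_pow_lt_pow_left₀ 2 hr0.le ?_
      nlinarith [mul_pos (by positivity : (0 : ℝ) < 8 * d ^ 2) hr0]
    have har : r + 2 * d < ‖p - K‖ := by
      refine lt_of_pow_lt_pow_left₀ 2 ha0 ?_
      nlinarith [mul_nonneg (by nlinarith : (0 : ℝ) ≤ (d : ℝ) ^ 2 - d) hr0.le,
        mul_nonneg (sq_nonneg (d : ℝ)) (sub_nonneg.2 hr)]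
    have hyp : ‖y‖ ≤ ‖p‖ + d := by
      have := norm_le_norm_add_norm_sub' y p
      linarith
    have hyk : ‖p - K‖ - d ≤ ‖y - K‖ := by
      have := norm_le_norm_add_norm_sub' (p - K) (y - K)
      have h3 : p - K - (y - K) = -(y - p) := by abel
      rw [h3, norm_neg] at this
      linarith
    refine ⟨⟨?_, ?_⟩, ?_⟩
    · have : ‖y‖ ^ 2 ≤ (‖p‖ + d) ^ 2 := pow_le_pow_left₀ (norm_nonneg y) hyp 2
      nlinarith [mul_nonneg (by nlinarith : (0 : ℝ) ≤ (d : ℝ) ^ 2 - d) hr0.le,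
        mul_nonneg (sq_nonneg (d : ℝ)) (sub_nonneg.2 hr),
        mul_nonneg (by linarith : (0 : ℝ) ≤ d) (sub_nonneg.2 hpr.le)]
    · have : r < ‖y - K‖ := by linarith
      exact pow_lt_pow_left₀ this hr0.le two_ne_zero
    · have e1 : ‖y - K‖ ^ 2 - ‖y‖ ^ 2 =
          ‖p - K‖ ^ 2 - ‖p‖ ^ 2 - 2 * inner ℝ (y - p) K := by
        rw [norm_sub_sq_real, norm_sub_sq_real, inner_sub_left]
        ring
      have e2 : |inner ℝ (y - p) K| ≤ d * ‖K‖ :=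
        (abs_real_inner_le_norm _ _).trans (mul_le_mul_of_nonneg_right hy' (norm_nonneg K))
      have e3 : ‖K‖ ≤ ‖p - K‖ + ‖p‖ := by
        have := norm_sub_le p (p - K)
        rw [sub_sub_cancel] at this
        linarith
      have e4 : d * ‖K‖ ≤ d * (‖p - K‖ + ‖p‖) := by gcongr
      have e5 : (2 * d) * (‖p - K‖ + ‖p‖) ≤ (‖p - K‖ - ‖p‖) * (‖p - K‖ + ‖p‖) := by
        gcongr
        linarith
      nlinarith [neg_abs_le (inner ℝ (y - p) K)]
  have hpos : ∀ n ∈ G, 0 < ‖latticePoint (n - k)‖ ^ 2 - ‖latticePoint n‖ ^ 2 := by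
    intro n hn
    have : 0 < 8 * (d : ℝ) ^ 2 * r := by positivity
    linarith [h1 n hn, h2 n hn]
  rw [← ENNReal.ofReal_le_ofReal_iff (by positivity), ENNReal.ofReal_sum_of_nonneg
    (fun n hn => (one_div_pos.2 (hpos n hn)).le)]
  calc ∑ n ∈ G, ENNReal.ofReal (1 / (‖latticePoint (n - k)‖ ^ 2 - ‖latticePoint n‖ ^ 2))
      ≤ ∫⁻ y in {y | ‖y‖ ^ 2 < r ^ 2 ∧ r ^ 2 < ‖y - latticePoint k‖ ^ 2},
          2 * ENNReal.ofReal (1 / (‖y - latticePoint k‖ ^ 2 - ‖y‖ ^ 2)) := by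
        refine sum_le_lintegral_of_latticeCell G _ _ (fun n hn y hy => (hkey n hn y hy).1) ?_
        intro n hn y hy
        obtain ⟨⟨k1, k2⟩, k3⟩ := hkey n hn y hy
        have hD : 0 < ‖y - latticePoint k‖ ^ 2 - ‖y‖ ^ 2 := by linarith
        rw [show (2 : ENNReal) * ENNReal.ofReal (1 / (‖y - latticePoint k‖ ^ 2 - ‖y‖ ^ 2)) =
          ENNReal.ofReal (2 * (1 / (‖y - latticePoint k‖ ^ 2 - ‖y‖ ^ 2))) by
            rw [ENNReal.ofReal_mul two_pos.le, ENNReal.ofReal_ofNat]]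
        apply ENNReal.ofReal_le_ofReal
        rw [mul_one_div, div_le_div_iff₀ (hpos n hn) hD]
        linarith
    _ ≤ _ := by
        rw [lintegral_const_mul' _ _ ENNReal.ofNat_ne_top, ENNReal.ofReal_mul two_pos.le,
          ENNReal.ofReal_ofNat]
        gcongr
        exact lintegral_lindhard_le hd (by simp) hr0 _

/-- The constant in the bound on the number of lattice points in a shell. -/
def shellConst (d : ℕ) : ℝ :=
  ballVolume d * d * (1 + 2 * d) ^ (d - 1) * (3 * d + 1) * 2 ^ d

theorem shellConst_pos {d : ℕ} (hd : 2 ≤ d) : 0 < shellConst d := by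
  have := ballVolume_pos d
  have : (0 : ℝ) < d := by exact_mod_cast (by omega : 0 < d)
  unfold shellConst
  positivity

theorem card_shell_le_aux {d : ℕ} (hd : 2 ≤ d) {M T s : ℝ} (hM : 0 ≤ M) (hT : 0 ≤ T)
    (hs : s = max 1 √(M + T)) (G : Finset (Fin d → ℤ))
    (hG : ∀ n ∈ G, |‖latticePoint n‖ ^ 2 - M| ≤ T) :
    (G.card : ℝ) ≤ ballVolume d * (d * ((1 + 2 * d) * s) ^ (d - 1) * (2 * T / s + (3 * d + 1))) := by
  have hd0 : (0 : ℝ) < d := by exact_mod_cast (by omega : 0 < d)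
  have : NeZero d := ⟨by omega⟩
  have hω := ballVolume_pos d
  have hs1 : 1 ≤ s := hs ▸ le_max_left _ _
  have hs0 : 0 < s := by linarith
  set u := √(M + T) with hu
  set v := √(M - T) with hv
  have hus : u ≤ s := hs ▸ le_max_right _ _
  have hu0 : 0 ≤ u := Real.sqrt_nonneg _
  have hv0 : 0 ≤ v := Real.sqrt_nonneg _
  have hvu : v ≤ u := Real.sqrt_le_sqrt (by linarith)
  have hu2 : u ^ 2 = M + T := Real.sq_sqrt (by linarith)
  have hv2 : M - T ≤ v ^ 2 := by
    rcases le_or_gt 0 (M - T) with h | h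
    · exact (Real.sq_sqrt h).ge
    · nlinarith [sq_nonneg v]
  set b := u + 2 * d with hb
  set a := max (v - d) 0 with ha
  have ha0 : 0 ≤ a := le_max_right _ _
  have hab : a ≤ b := max_le (by linarith) (by positivity)
  have hbs : b ≤ (1 + 2 * d) * s := by nlinarith
  have hba : b - a ≤ 2 * T / s + (3 * d + 1) := by
    have h1 : v - d ≤ a := le_max_left _ _
    have h2 : u - v ≤ 2 * T / s + 1 := by
      rcases le_total 1 u with h | h
      · have hsu : s = u := by rw [hs, max_eq_right h]
        have : (u - v) ≤ 2 * T / s := by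
          rw [le_div_iff₀ hs0, hsu]
          nlinarith
        linarith
      · have : 0 ≤ 2 * T / s := by positivity
        linarith
    linarith
  have hsub : ∀ n ∈ G, latticeCell n ⊆ Metric.ball (0 : EuclideanSpace ℝ (Fin d)) b \
      Metric.ball 0 a := by
    intro n hn y hy
    have hy' := norm_sub_latticePoint_le hy
    have h1 := norm_le_norm_add_norm_sub' y (latticePoint n)
    have h2 := norm_le_norm_add_norm_sub (latticePoint n) y
    rw [norm_sub_rev] at h2
    have hGn := abs_le.1 (hG n hn)
    have h3 : ‖latticePoint n‖ ≤ u := Real.le_sqrt_of_sq_le (by linarith)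
    have h4 : v ≤ ‖latticePoint n‖ := by
      rw [hv, Real.sqrt_le_left (norm_nonneg _)]
      linarith
    have h5 : ‖latticePoint n‖ ≤ ‖y‖ + d := by
      have := norm_le_norm_add_norm_sub' (latticePoint n) y
      rw [norm_sub_rev] at this
      linarith
    simp only [Set.mem_sdiff, mem_ball_zero_iff, not_lt]
    constructor
    · linarith
    · exact max_le (by linarith) (norm_nonneg y)
  have hcount := sum_le_lintegral_of_latticeCell G (fun _ => 1) (fun _ => 1) hsub
    (fun _ _ _ _ => le_rfl)
  rw [setLIntegral_one, volume_ball_sdiff_ball ha0 hab, finrank_euclideanSpace_fin] at hcount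
  simp only [Finset.sum_const, nsmul_eq_mul, mul_one] at hcount
  rw [← ENNReal.ofReal_natCast, ENNReal.ofReal_le_ofReal_iff
    (mul_nonneg hω.le (sub_nonneg.2 (pow_le_pow_left₀ ha0 hab d)))] at hcount
  refine hcount.trans ?_
  gcongr
  refine (pow_sub_pow_le_mul_pow ha0 hab d).trans ?_
  have : 0 ≤ b - a := sub_nonneg.2 hab
  have : 0 ≤ b := ha0.trans hab
  gcongr

/-- The number of lattice points `n` with `||n|² - M| ≤ T`. -/
theorem card_shell_le {d : ℕ} (hd : 2 ≤ d) {M T : ℝ} (hM : 0 ≤ M) (hT : 0 ≤ T)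
    (G : Finset (Fin d → ℤ)) (hG : ∀ n ∈ G, |‖latticePoint n‖ ^ 2 - M| ≤ T) :
    (G.card : ℝ) ≤ shellConst d *
      (max 1 √M ^ (d - 2) * T + √T ^ d + max 1 √M ^ (d - 1)) := by
  have hd0 : (0 : ℝ) < d := by exact_mod_cast (by omega : 0 < d)
  have hω := ballVolume_pos d
  refine (card_shell_le_aux hd hM hT rfl G hG).trans ?_
  set s := max 1 √(M + T) with hs
  set R := max 1 √M with hR
  have hs1 : 1 ≤ s := le_max_left _ _
  have hR1 : 1 ≤ R := le_max_left _ _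
  have hMR : M ≤ R ^ 2 := Real.sqrt_le_left (by positivity) |>.1 (le_max_right _ _)
  obtain ⟨m, rfl⟩ : ∃ m, d = m + 2 := ⟨d - 2, by omega⟩
  simp only [Nat.add_sub_cancel, show m + 2 - 1 = m + 1 by omega]
  have h1 : s ^ (m + 1) * (2 * T / s + (3 * (m + 2 : ℕ) + 1)) ≤
      (3 * (m + 2 : ℕ) + 1) * (s ^ m * T + s ^ (m + 1)) := by
    have e : s ^ (m + 1) * (2 * T / s) = 2 * (s ^ m * T) := by
      field_simp
      ring
    rw [mul_add, e]
    have : (0 : ℝ) ≤ s ^ m * T := by positivity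
    push_cast
    nlinarith [(Nat.cast_nonneg m : (0 : ℝ) ≤ m)]
  have h2 : s ^ m * T + s ^ (m + 1) ≤
      2 ^ (m + 2) * (R ^ m * T + √T ^ (m + 2) + R ^ (m + 1)) := by
    have hsT : s ≤ √(R ^ 2 + T) := by
      refine max_le ?_ (Real.sqrt_le_sqrt (by linarith))
      rw [Real.le_sqrt' one_pos]
      nlinarith
    have p1 : (2 : ℝ) ^ m ≤ 2 ^ (m + 2) := pow_le_pow_right₀ one_le_two (by omega)
    have p2 : (2 : ℝ) ^ (m + 1) ≤ 2 ^ (m + 2) := pow_le_pow_right₀ one_le_two (by omega)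
    have hRm : (0 : ℝ) ≤ R ^ m * T := by positivity
    have hTm : (0 : ℝ) ≤ √T ^ (m + 2) := by positivity
    have hRm' : (0 : ℝ) ≤ R ^ (m + 1) := by positivity
    rcases le_total T (R ^ 2) with h | h
    · have hs2 : s ≤ 2 * R := hsT.trans (by
        rw [Real.sqrt_le_left (by positivity)]; nlinarith [sq_nonneg R])
      have q1 : s ^ m ≤ 2 ^ m * R ^ m := by rw [← mul_pow]; gcongr
      have q2 : s ^ (m + 1) ≤ 2 ^ (m + 1) * R ^ (m + 1) := by rw [← mul_pow]; gcongr
      calc s ^ m * T + s ^ (m + 1) ≤ 2 ^ m * R ^ m * T + 2 ^ (m + 1) * R ^ (m + 1) := by gcongr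
        _ = 2 ^ m * (R ^ m * T) + 2 ^ (m + 1) * R ^ (m + 1) := by ring
        _ ≤ 2 ^ (m + 2) * (R ^ m * T) + 2 ^ (m + 2) * R ^ (m + 1) := by gcongr
        _ ≤ _ := by nlinarith [mul_nonneg (by positivity : (0 : ℝ) ≤ 2 ^ (m + 2)) hTm]
    · have hT1 : 1 ≤ √T := by rw [Real.le_sqrt' one_pos]; nlinarith
      have hTT : √T ^ 2 = T := Real.sq_sqrt hT
      have hs2 : s ≤ 2 * √T := hsT.trans (by
        rw [Real.sqrt_le_left (by positivity)]; nlinarith)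
      have q1 : s ^ m ≤ 2 ^ m * √T ^ m := by rw [← mul_pow]; gcongr
      have q2 : s ^ (m + 1) ≤ 2 ^ (m + 1) * √T ^ (m + 1) := by rw [← mul_pow]; gcongr
      have q3 : √T ^ (m + 1) ≤ √T ^ (m + 2) := pow_le_pow_right₀ hT1 (by omega)
      calc s ^ m * T + s ^ (m + 1) ≤ 2 ^ m * √T ^ m * T + 2 ^ (m + 1) * √T ^ (m + 2) :=
            add_le_add (by gcongr) (q2.trans (by gcongr))
        _ = 2 ^ m * (√T ^ (m + 2)) + 2 ^ (m + 1) * √T ^ (m + 2) := by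
            rw [show √T ^ (m + 2) = √T ^ m * T by rw [pow_add, hTT]]
            ring
        _ ≤ 2 ^ (m + 2) * √T ^ (m + 2) := by
            have : (2 : ℝ) ^ (m + 2) = 2 ^ m + 2 ^ (m + 1) + 2 ^ m := by ring
            nlinarith [mul_nonneg (by positivity : (0 : ℝ) ≤ 2 ^ m) hTm]
        _ ≤ _ := by
            have : (0 : ℝ) ≤ 2 ^ (m + 2) := by positivity
            gcongr
            linarith
  calc _ = ballVolume (m + 2) * (m + 2 : ℕ) * (1 + 2 * (m + 2 : ℕ)) ^ (m + 1) *
        (s ^ (m + 1) * (2 * T / s + (3 * (m + 2 : ℕ) + 1))) := by rw [mul_pow]; ring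
    _ ≤ ballVolume (m + 2) * (m + 2 : ℕ) * (1 + 2 * (m + 2 : ℕ)) ^ (m + 1) *
        ((3 * (m + 2 : ℕ) + 1) *
          (2 ^ (m + 2) * (R ^ m * T + √T ^ (m + 2) + R ^ (m + 1)))) := by
        refine mul_le_mul_of_nonneg_left (h1.trans ?_) (by positivity)
        exact mul_le_mul_of_nonneg_left h2 (by positivity)
    _ = _ := by
        rw [shellConst, show m + 2 - 1 = m + 1 by omega]
        ring

/-! ### Operators between `0` and `1` -/

section Operators

variable {H : Type*} [NormedAddCommGroup H] [InnerProductSpace ℂ H] {A : H →L[ℂ] H}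

theorem re_inner_apply_nonneg (hA : 0 ≤ A) (v : H) : 0 ≤ (inner ℂ v (A v)).re :=
  ((ContinuousLinearMap.nonneg_iff_isPositive A).1 hA).re_inner_nonneg_right v

theorem inner_apply_comm (hA : 0 ≤ A) (u v : H) : inner ℂ (A u) v = inner ℂ u (A v) :=
  ((ContinuousLinearMap.nonneg_iff_isPositive A).1 hA).inner_left_eq_inner_right u v

theorem one_sub_nonneg_of_le_one (hA : A ≤ 1) : 0 ≤ 1 - A :=
  (ContinuousLinearMap.nonneg_iff_isPositive _).2 ((ContinuousLinearMap.le_def _ _).1 hA)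

theorem one_sub_le_one_of_nonneg (hA : 0 ≤ A) : 1 - A ≤ 1 := by
  rw [ContinuousLinearMap.le_def, sub_sub_cancel]
  exact (ContinuousLinearMap.nonneg_iff_isPositive _).1 hA

theorem re_inner_apply_le (hA : A ≤ 1) (v : H) : (inner ℂ v (A v)).re ≤ ‖v‖ ^ 2 := by
  have h := re_inner_apply_nonneg (one_sub_nonneg_of_le_one hA) v
  simp only [sub_apply, one_apply_eq_self, inner_sub_right,
    Complex.sub_re, inner_self_eq_norm_sq_to_K] at h
  have h' : ((‖v‖ : ℂ) ^ 2).re = ‖v‖ ^ 2 := by norm_cast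
  erw [h'] at h
  linarith

theorem re_inner_apply_comm (hA : 0 ≤ A) (u v : H) :
    (inner ℂ u (A v)).re = (inner ℂ v (A u)).re := by
  rw [← inner_apply_comm hA u v, ← inner_conj_symm, Complex.conj_re]

theorem re_inner_apply_add_le (hA : 0 ≤ A) (u v : H) :
    (inner ℂ (u + v) (A (u + v))).re ≤ 2 * (inner ℂ u (A u)).re + 2 * (inner ℂ v (A v)).re := by
  have h := re_inner_apply_nonneg hA (u - v)
  simp only [map_sub, map_add, inner_sub_left, inner_sub_right, inner_add_left, inner_add_right,
    Complex.sub_re, Complex.add_re] at h ⊢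
  linarith

/-- `A² ≤ A` for `0 ≤ A ≤ 1`, because `A - A² = A(1-A)A + (1-A)A(1-A)`. -/
theorem norm_apply_sq_le (hA : 0 ≤ A) (hA1 : A ≤ 1) (v : H) :
    ‖A v‖ ^ 2 ≤ (inner ℂ v (A v)).re := by
  have h1 := re_inner_apply_le hA1 (A v)
  have h2 := re_inner_apply_nonneg hA (v - A v)
  have h3 : (inner ℂ (A v) (A v)).re = ‖A v‖ ^ 2 := by
    rw [inner_self_eq_norm_sq_to_K]; norm_cast
  have h4 : inner ℂ v (A (A v)) = inner ℂ (A v) (A v) := (inner_apply_comm hA _ _).symm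
  simp only [map_sub, inner_sub_left, inner_sub_right, Complex.sub_re, h4, h3] at h2
  linarith

theorem two_mul_abs_re_inner_le (u v : H) : 2 * |(inner ℂ u v).re| ≤ ‖u‖ ^ 2 + ‖v‖ ^ 2 := by
  have h1 : |(inner ℂ u v).re| ≤ ‖u‖ * ‖v‖ :=
    (Complex.abs_re_le_norm _).trans (norm_inner_le_norm u v)
  nlinarith [sq_nonneg (‖u‖ - ‖v‖)]

/-- The quadratic form of `γ - N` at `s + u + v`, where `u` lies in the kernel and `v` in the range
of the projection `N`, up to the off-diagonal term between `u` and `v`. -/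
theorem abs_re_inner_sub_le {γ N : H →L[ℂ] H} (hγ : 0 ≤ γ) (hγ1 : γ ≤ 1) (hN : 0 ≤ N)
    (hN1 : N ≤ 1) (s : H) {u v : H} (hu : N u = 0) (hv : N v = v) :
    |(inner ℂ (s + v + u) ((γ - N) (s + v + u))).re - 2 * (inner ℂ v (γ u)).re| ≤
      3 * ‖s‖ ^ 2 + 2 * (inner ℂ u (γ u)).re + 2 * (inner ℂ v ((1 - γ) v)).re := by
  have hδ : 0 ≤ 1 - γ := one_sub_nonneg_of_le_one hγ1
  have hδ1 : 1 - γ ≤ 1 := one_sub_le_one_of_nonneg hγ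
  have huv : inner ℂ u v = 0 := by
    rw [← hv, ← inner_apply_comm hN, hu, inner_zero_left]
  have e1 : (inner ℂ (s + v + u) ((γ - N) (s + v + u))).re = (inner ℂ s (γ s)).re -
      (inner ℂ s (N s)).re + 2 * (inner ℂ s (γ u)).re - 2 * (inner ℂ s ((1 - γ) v)).re +
      (inner ℂ u (γ u)).re - (inner ℂ v ((1 - γ) v)).re + 2 * (inner ℂ v (γ u)).re := by
    have c1 := re_inner_apply_comm hγ u s
    have c2 := re_inner_apply_comm hγ v s
    have c3 := re_inner_apply_comm hγ u v
    have c4 := re_inner_apply_comm hN u s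
    have c5 := re_inner_apply_comm hN v s
    simp only [hu, hv, inner_zero_right, Complex.zero_re] at c4 c5
    simp only [sub_apply, one_apply_eq_self, map_add, inner_add_left,
      inner_add_right, inner_sub_right, Complex.add_re, Complex.sub_re, hu, hv, huv,
      inner_zero_right, Complex.zero_re]
    linarith
  have b1 := two_mul_abs_re_inner_le s (γ u)
  have b2 := two_mul_abs_re_inner_le s ((1 - γ) v)
  have b3 := norm_apply_sq_le hγ hγ1 u
  have b4 := norm_apply_sq_le hδ hδ1 v
  have b5 := re_inner_apply_nonneg hγ s
  have b6 := re_inner_apply_nonneg hN s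
  have b7 := re_inner_apply_le hγ1 s
  have b8 := re_inner_apply_le hN1 s
  have b9 := re_inner_apply_nonneg hγ u
  have b10 := re_inner_apply_nonneg hδ v
  have t1 := abs_le.1 (le_refl |(inner ℂ s (γ u)).re|)
  have t2 := abs_le.1 (le_refl |(inner ℂ s ((1 - γ) v)).re|)
  rw [e1, abs_le]
  constructor <;> linarith [t1.1, t1.2, t2.1, t2.2]

end Operators

/-! ### Densities of operators in a basis of plane waves -/

/-- An orthonormal family of unimodular functions, indexed by an abelian group `G`, that is
multiplicative in the index: the exponentials `x ↦ e^{ik·x}` on a torus, as functions. -/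
structure IsCharacterFamily {G X : Type*} [AddCommGroup G] [MeasurableSpace X] (P : Measure X)
    (χ : G → X → ℂ) : Prop where
  measurable : ∀ n, Measurable (χ n)
  norm_eq_one : ∀ n x, ‖χ n x‖ = 1
  sub : ∀ n m x, χ (n - m) x = χ n x * (starRingEnd ℂ) (χ m x)
  integral_eq_zero : ∀ n, n ≠ 0 → ∫ x, χ n x ∂P = 0

section Characters

variable {G X : Type*} [AddCommGroup G] [MeasurableSpace X] {P : Measure X}
  [IsProbabilityMeasure P] {χ : G → X → ℂ}

omit [IsProbabilityMeasure P] in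
theorem IsCharacterFamily.zero (hχ : IsCharacterFamily P χ) (x : X) : χ 0 x = 1 := by
  have h := hχ.sub 0 0 x
  rwa [sub_zero, Complex.mul_conj, Complex.normSq_eq_norm_sq, hχ.norm_eq_one, one_pow,
    Complex.ofReal_one] at h

theorem IsCharacterFamily.integrable (hχ : IsCharacterFamily P χ) (n : G) :
    Integrable (χ n) P :=
  Integrable.of_bound (hχ.measurable n).aestronglyMeasurable 1
    (Filter.Eventually.of_forall fun x => (hχ.norm_eq_one n x).le)

theorem IsCharacterFamily.integral_sub [DecidableEq G] (hχ : IsCharacterFamily P χ) (n m : G) :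
    ∫ x, χ (n - m) x ∂P = if n = m then 1 else 0 := by
  split_ifs with h
  · simp [h, hχ.zero]
  · exact hχ.integral_eq_zero _ (sub_ne_zero.2 h)

/-- Parseval's identity for finite sums. -/
theorem IsCharacterFamily.integral_norm_sum_sq (hχ : IsCharacterFamily P χ) (K : Finset G)
    (b : G → ℂ) : ∫ x, ‖∑ k ∈ K, b k * χ k x‖ ^ 2 ∂P = ∑ k ∈ K, ‖b k‖ ^ 2 := by
  classical
  have h1 : ∀ x, ((‖∑ k ∈ K, b k * χ k x‖ ^ 2 : ℝ) : ℂ) =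
      ∑ k ∈ K, ∑ l ∈ K, b k * (starRingEnd ℂ) (b l) * χ (k - l) x := by
    intro x
    rw [Complex.ofReal_pow, ← Complex.mul_conj', map_sum, Finset.sum_mul_sum]
    refine Finset.sum_congr rfl fun k _ => Finset.sum_congr rfl fun l _ => ?_
    rw [hχ.sub, map_mul]
    ring
  have h2 : ((∫ x, ‖∑ k ∈ K, b k * χ k x‖ ^ 2 ∂P : ℝ) : ℂ) = ∑ k ∈ K, ((‖b k‖ ^ 2 : ℝ) : ℂ) := by
    rw [← integral_complex_ofReal]
    simp_rw [h1]
    rw [integral_finsetSum _ fun k _ => integrable_finsetSum _ fun l _ =>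
      (hχ.integrable _).const_mul _]
    refine Finset.sum_congr rfl fun k hk => ?_
    rw [integral_finsetSum _ fun l _ => (hχ.integrable _).const_mul _]
    simp_rw [integral_const_mul, hχ.integral_sub]
    simp only [mul_ite, mul_one, mul_zero, Finset.sum_ite_eq, hk, if_true]
    rw [Complex.mul_conj', Complex.ofReal_pow]
  exact_mod_cast h2

variable {H : Type*} [NormedAddCommGroup H] [InnerProductSpace ℂ H] {ι : Type*}
  {e : G × ι → H}

/-- The projection of the delta function at the point `x` with spin `σ` to the modes in `F`. -/
def wavePacket (χ : G → X → ℂ) (e : G × ι → H) (F : Finset G) (x : X) (σ : ι) : H :=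
  ∑ n ∈ F, (starRingEnd ℂ) (χ n x) • e (n, σ)

omit [AddCommGroup G] [MeasurableSpace X] in
theorem wavePacket_union [DecidableEq G] {F F' : Finset G} (h : Disjoint F F') (x : X) (σ : ι) :
    wavePacket χ e (F ∪ F') x σ = wavePacket χ e F x σ + wavePacket χ e F' x σ :=
  Finset.sum_union h

omit [IsProbabilityMeasure P] in
theorem norm_wavePacket_sq (hχ : IsCharacterFamily P χ) (he : Orthonormal ℂ e) (F : Finset G)
    (x : X) (σ : ι) : ‖wavePacket χ e F x σ‖ ^ 2 = F.card := by
  have he' : Orthonormal ℂ fun n : G => e (n, σ) :=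
    he.comp (fun n => (n, σ)) fun a b h => congrArg Prod.fst h
  have h := he'.inner_sum (fun n => (starRingEnd ℂ) (χ n x)) (fun n => (starRingEnd ℂ) (χ n x)) F
  rw [inner_self_eq_norm_sq_to_K] at h
  simp only [Complex.conj_conj, Complex.mul_conj', hχ.norm_eq_one, Complex.ofReal_one, one_pow,
    Finset.sum_const, nsmul_eq_mul, mul_one] at h
  have h' : ((‖wavePacket χ e F x σ‖ ^ 2 : ℝ) : ℂ) = ((F.card : ℝ) : ℂ) := by
    rw [Complex.ofReal_pow, Complex.ofReal_natCast]
    exact h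
  exact_mod_cast h'

variable [Fintype ι]

/-- The density at `x` of the operator `A` compressed to the modes in `F` on the left and in `F'`
on the right, `∑_σ (1_F A 1_{F'})(x, σ; x, σ)`, up to normalization. -/
def localDensity (χ : G → X → ℂ) (e : G × ι → H) (A : H →L[ℂ] H) (F F' : Finset G) (x : X) : ℂ :=
  ∑ σ, inner ℂ (wavePacket χ e F x σ) (A (wavePacket χ e F' x σ))

omit [IsProbabilityMeasure P] in
theorem localDensity_eq_sum (hχ : IsCharacterFamily P χ) (A : H →L[ℂ] H) (F F' : Finset G)
    (x : X) : localDensity χ e A F F' x =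
      ∑ n ∈ F, ∑ m ∈ F', (∑ σ, inner ℂ (e (n, σ)) (A (e (m, σ)))) * χ (n - m) x := by
  simp only [localDensity, wavePacket, map_sum, map_smul, sum_inner, inner_sum, inner_smul_left,
    inner_smul_right, Complex.conj_conj, Finset.sum_mul, hχ.sub]
  simp only [Finset.mul_sum]
  refine (Finset.sum_congr rfl fun σ _ => Finset.sum_comm).trans ?_
  rw [Finset.sum_comm]
  refine Finset.sum_congr rfl fun n _ => ?_
  rw [Finset.sum_comm]
  refine Finset.sum_congr rfl fun m _ => Finset.sum_congr rfl fun σ _ => ?_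
  ring

omit [IsProbabilityMeasure P] in
theorem measurable_localDensity (hχ : IsCharacterFamily P χ) (A : H →L[ℂ] H) (F F' : Finset G) :
    Measurable (localDensity χ e A F F') := by
  have : localDensity χ e A F F' = fun x =>
      ∑ n ∈ F, ∑ m ∈ F', (∑ σ, inner ℂ (e (n, σ)) (A (e (m, σ)))) * χ (n - m) x :=
    funext (localDensity_eq_sum hχ A F F')
  rw [this]
  exact Finset.measurable_sum _ fun n _ => Finset.measurable_sum _ fun m _ =>
    (hχ.measurable _).const_mul _

theorem integrable_localDensity (hχ : IsCharacterFamily P χ) (A : H →L[ℂ] H) (F F' : Finset G) :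
    Integrable (localDensity χ e A F F') P := by
  have : localDensity χ e A F F' = fun x =>
      ∑ n ∈ F, ∑ m ∈ F', (∑ σ, inner ℂ (e (n, σ)) (A (e (m, σ)))) * χ (n - m) x :=
    funext (localDensity_eq_sum hχ A F F')
  rw [this]
  exact integrable_finsetSum _ fun n _ => integrable_finsetSum _ fun m _ =>
    (hχ.integrable _).const_mul _

theorem integral_localDensity_self (hχ : IsCharacterFamily P χ) (A : H →L[ℂ] H) (F : Finset G) :
    ∫ x, localDensity χ e A F F x ∂P = ∑ n ∈ F, ∑ σ, inner ℂ (e (n, σ)) (A (e (n, σ))) := by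
  classical
  simp_rw [localDensity_eq_sum hχ]
  rw [integral_finsetSum _ fun k _ => integrable_finsetSum _ fun l _ =>
    (hχ.integrable _).const_mul _]
  refine Finset.sum_congr rfl fun n hn => ?_
  rw [integral_finsetSum _ fun l _ => (hχ.integrable _).const_mul _]
  simp_rw [integral_const_mul, hχ.integral_sub]
  simp only [mul_ite, mul_one, mul_zero, Finset.sum_ite_eq, hn, if_true]

omit [AddCommGroup G] [MeasurableSpace X] in
theorem re_localDensity_nonneg {A : H →L[ℂ] H} (hA : 0 ≤ A) (F : Finset G) (x : X) :
    0 ≤ (localDensity χ e A F F x).re := by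
  rw [localDensity, Complex.re_sum]
  exact Finset.sum_nonneg fun σ _ => re_inner_apply_nonneg hA _

omit [IsProbabilityMeasure P] in
theorem re_localDensity_le_card (hχ : IsCharacterFamily P χ) (he : Orthonormal ℂ e)
    {A : H →L[ℂ] H} (hA : A ≤ 1) (F : Finset G) (x : X) :
    (localDensity χ e A F F x).re ≤ Fintype.card ι * F.card := by
  rw [localDensity, Complex.re_sum]
  refine (Finset.sum_le_sum fun σ _ => re_inner_apply_le hA _).trans ?_
  simp [norm_wavePacket_sq hχ he]

omit [AddCommGroup G] [MeasurableSpace X] in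
theorem re_localDensity_union_le [DecidableEq G] {A : H →L[ℂ] H} (hA : 0 ≤ A) {F F' : Finset G}
    (h : Disjoint F F') (x : X) :
    (localDensity χ e A (F ∪ F') (F ∪ F') x).re ≤
      2 * (localDensity χ e A F F x).re + 2 * (localDensity χ e A F' F' x).re := by
  simp only [localDensity, Complex.re_sum, Finset.mul_sum, ← Finset.sum_add_distrib,
    wavePacket_union h]
  exact Finset.sum_le_sum fun σ _ => re_inner_apply_add_le hA _ _

/-- **Rumin's inequality.** The energy of `A` is the integral over `T` of the mass that `A` has in
the modes of energy larger than `T`; at each point this mass is at least a quarter of the density,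
as long as the modes of energy at most `T` cannot carry a quarter of it. -/
theorem lintegral_density_mul_le (hχ : IsCharacterFamily P χ) (he : Orthonormal ℂ e)
    {A : H →L[ℂ] H} (hA : 0 ≤ A) (hA1 : A ≤ 1) (F : Finset G) {ε : G → ℝ} (hε : ∀ n, 0 ≤ ε n)
    (E : X → ℝ) (hE : ∀ x, ∀ T, 0 < T → T < E x →
      4 * (Fintype.card ι * ((F.filter fun n => ε n ≤ T).card : ℝ)) ≤
        (localDensity χ e A F F x).re) :
    ∫⁻ x, ENNReal.ofReal ((localDensity χ e A F F x).re / 4 * E x) ∂P ≤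
      ENNReal.ofReal (∑ n ∈ F, ε n * ∑ σ, (inner ℂ (e (n, σ)) (A (e (n, σ)))).re) := by
  classical
  set a : G → ℝ := fun n => ∑ σ, (inner ℂ (e (n, σ)) (A (e (n, σ)))).re with ha
  have ha0 : ∀ n, 0 ≤ a n := fun n => Finset.sum_nonneg fun σ _ => re_inner_apply_nonneg hA _
  set D : X → ℝ → ENNReal := fun x T => ENNReal.ofReal
    (localDensity χ e A (F.filter fun n => T < ε n) (F.filter fun n => T < ε n) x).re with hD
  have hlow : ∀ x, ∀ T, 0 < T → T < E x →
      ENNReal.ofReal ((localDensity χ e A F F x).re / 4) ≤ D x T := by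
    intro x T hT0 hT
    have h1 := hE x T hT0 hT
    have hdis : Disjoint (F.filter fun n => ε n ≤ T) (F.filter fun n => T < ε n) :=
      Finset.disjoint_filter.2 fun n _ h => not_lt.2 h
    have hun : (F.filter fun n => ε n ≤ T) ∪ (F.filter fun n => T < ε n) = F := by
      ext n
      simp only [Finset.mem_union, Finset.mem_filter, ← and_or_left, and_iff_left_iff_imp]
      exact fun _ => le_or_gt _ _
    have h2 := re_localDensity_union_le (χ := χ) (e := e) hA hdis x
    rw [hun] at h2
    have h3 := re_localDensity_le_card hχ he hA1 (F.filter fun n => ε n ≤ T) x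
    exact ENNReal.ofReal_le_ofReal (by linarith)
  have hmeas : Measurable (Function.uncurry D) := by
    have : Function.uncurry D = fun p : X × ℝ => ENNReal.ofReal
        (∑ n ∈ F, if p.2 < ε n then (∑ m ∈ F, if p.2 < ε m then
          (∑ σ, inner ℂ (e (n, σ)) (A (e (m, σ)))) * χ (n - m) p.1 else 0) else 0).re := by
      ext p
      simp only [Function.uncurry, hD]
      rw [localDensity_eq_sum hχ, Finset.sum_filter]
      simp only [Finset.sum_filter]
    rw [this]
    refine (Complex.measurable_re.comp (Finset.measurable_sum _ fun n _ => ?_)).ennreal_ofReal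
    refine Measurable.ite (measurableSet_lt measurable_snd measurable_const) ?_ measurable_const
    refine Finset.measurable_sum _ fun m _ => ?_
    refine Measurable.ite (measurableSet_lt measurable_snd measurable_const) ?_ measurable_const
    exact ((hχ.measurable _).comp measurable_fst).const_mul _
  have hint : ∀ T, ∫⁻ x, D x T ∂P = ∑ n ∈ F, if T < ε n then ENNReal.ofReal (a n) else 0 := by
    intro T
    rw [← Finset.sum_filter, ← ENNReal.ofReal_sum_of_nonneg fun n _ => ha0 n]
    refine (ofReal_integral_eq_lintegral_ofReal
        (integrable_localDensity hχ A _ _).re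
        (Filter.Eventually.of_forall fun x => re_localDensity_nonneg hA _ x)).symm.trans ?_
    congr 1
    have h1 := integral_re (𝕜 := ℂ) (μ := P) (integrable_localDensity (e := e) hχ A
      (F.filter fun n => T < ε n) (F.filter fun n => T < ε n))
    refine h1.trans ?_
    rw [integral_localDensity_self hχ]
    simp [ha]
  calc ∫⁻ x, ENNReal.ofReal ((localDensity χ e A F F x).re / 4 * E x) ∂P
      = ∫⁻ x, (∫⁻ _ in Set.Ioo 0 (E x),
          ENNReal.ofReal ((localDensity χ e A F F x).re / 4)) ∂P := by
        congr 1
        ext x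
        rw [setLIntegral_const, Real.volume_Ioo, sub_zero, ENNReal.ofReal_mul]
        exact div_nonneg (re_localDensity_nonneg hA _ x) (by norm_num)
    _ ≤ ∫⁻ x, (∫⁻ T in Set.Ioi 0, D x T) ∂P := by
        refine lintegral_mono fun x => ?_
        refine (setLIntegral_mono' measurableSet_Ioo fun T hT => hlow x T hT.1 hT.2).trans ?_
        exact lintegral_mono_set Set.Ioo_subset_Ioi_self
    _ = ∫⁻ T in Set.Ioi 0, (∫⁻ x, D x T ∂P) := lintegral_lintegral_swap hmeas.aemeasurable
    _ = ∑ n ∈ F, ENNReal.ofReal (ε n) * ENNReal.ofReal (a n) := by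
        simp_rw [hint]
        rw [lintegral_finsetSum _ fun n _ => Measurable.ite (measurableSet_lt (by fun_prop)
          measurable_const) measurable_const measurable_const]
        refine Finset.sum_congr rfl fun n _ => ?_
        have : (fun T : ℝ => if T < ε n then ENNReal.ofReal (a n) else 0) =
            (Set.Iio (ε n)).indicator fun _ => ENNReal.ofReal (a n) := by
          ext T; simp [Set.indicator]
        rw [this, setLIntegral_indicator measurableSet_Iio, setLIntegral_const, Set.inter_comm,
          Set.Ioi_inter_Iio, Real.volume_Ioo, sub_zero, mul_comm]
    _ = _ := by
        rw [ENNReal.ofReal_sum_of_nonneg fun n _ => mul_nonneg (hε n) (ha0 n)]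
        exact Finset.sum_congr rfl fun n _ => (ENNReal.ofReal_mul (hε n)).symm

/-- The `L²` bound for an off-diagonal density, from Parseval's identity and the Cauchy-Schwarz
inequality with weights `w`. -/
theorem integral_norm_localDensity_sq_le [DecidableEq G] (hχ : IsCharacterFamily P χ)
    (A : H →L[ℂ] H) (F F' : Finset G) {w : G × G → ℝ} {Φ : ℝ}
    (hw : ∀ p ∈ F ×ˢ F', 0 < w p)
    (hΦ : ∀ k, ∑ p ∈ F ×ˢ F' with p.1 - p.2 = k, 1 / w p ≤ Φ) :
    ∫ x, ‖localDensity χ e A F F' x‖ ^ 2 ∂P ≤ Φ * (Fintype.card ι *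
      ∑ p ∈ F ×ˢ F', w p * ∑ σ, ‖inner ℂ (e (p.1, σ)) (A (e (p.2, σ)))‖ ^ 2) := by
  set c : G × G → ℂ := fun p => ∑ σ, inner ℂ (e (p.1, σ)) (A (e (p.2, σ))) with hc
  set K : Finset G := (F ×ˢ F').image fun p => p.1 - p.2 with hK
  have hmap : ∀ p ∈ F ×ˢ F', p.1 - p.2 ∈ K := fun p hp => Finset.mem_image_of_mem _ hp
  have h1 : ∀ x, localDensity χ e A F F' x =
      ∑ k ∈ K, (∑ p ∈ F ×ˢ F' with p.1 - p.2 = k, c p) * χ k x := by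
    intro x
    rw [localDensity_eq_sum hχ, ← Finset.sum_product', ← Finset.sum_fiberwise_of_maps_to hmap]
    refine Finset.sum_congr rfl fun k _ => ?_
    rw [Finset.sum_mul]
    refine Finset.sum_congr rfl fun p hp => ?_
    rw [(Finset.mem_filter.1 hp).2]
  simp_rw [h1]
  rw [hχ.integral_norm_sum_sq, ← Finset.sum_fiberwise_of_maps_to hmap, Finset.mul_sum,
    Finset.mul_sum]
  refine Finset.sum_le_sum fun k _ => ?_
  have hw' : ∀ p ∈ (F ×ˢ F').filter (fun p => p.1 - p.2 = k), 0 < w p :=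
    fun p hp => hw p (Finset.mem_filter.1 hp).1
  calc ‖∑ p ∈ F ×ˢ F' with p.1 - p.2 = k, c p‖ ^ 2
      ≤ (∑ p ∈ F ×ˢ F' with p.1 - p.2 = k, ‖c p‖) ^ 2 := by
        gcongr
        exact norm_sum_le _ _
    _ ≤ (∑ p ∈ F ×ˢ F' with p.1 - p.2 = k, 1 / w p) *
        ∑ p ∈ F ×ˢ F' with p.1 - p.2 = k, w p * ‖c p‖ ^ 2 := by
        refine Finset.sum_sq_le_sum_mul_sum_of_sq_le_mul _ (fun p hp => ?_) (fun p hp => ?_)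
          (fun p hp => ?_)
        · exact (one_div_pos.2 (hw' p hp)).le
        · exact mul_nonneg (hw' p hp).le (sq_nonneg _)
        · have := (hw' p hp).ne'
          refine le_of_eq ?_
          field_simp
    _ ≤ Φ * ∑ p ∈ F ×ˢ F' with p.1 - p.2 = k, w p * ‖c p‖ ^ 2 := by
        gcongr
        · exact Finset.sum_nonneg fun p hp => mul_nonneg (hw' p hp).le (sq_nonneg _)
        · exact hΦ k
    _ ≤ _ := by
        have hΦ0 : 0 ≤ Φ := (Finset.sum_nonneg fun p hp =>
          (one_div_pos.2 (hw' p hp)).le).trans (hΦ k)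
        refine mul_le_mul_of_nonneg_left ?_ hΦ0
        rw [Finset.mul_sum]
        refine Finset.sum_le_sum fun p hp => ?_
        rw [mul_left_comm]
        refine mul_le_mul_of_nonneg_left ?_ (hw' p hp).le
        calc ‖c p‖ ^ 2 ≤ (∑ σ, ‖inner ℂ (e (p.1, σ)) (A (e (p.2, σ)))‖) ^ 2 := by
              gcongr
              exact norm_sum_le _ _
          _ ≤ _ := by
              simpa using sq_sum_le_card_mul_sum_sq (s := (Finset.univ : Finset ι))
                (f := fun σ => ‖inner ℂ (e (p.1, σ)) (A (e (p.2, σ)))‖)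

omit [AddCommGroup G] in
/-- The weighted Hilbert-Schmidt norm of the off-diagonal part of `γ` is controlled by the energy,
because `γ² ≤ γ` and `(1 - γ)² ≤ 1 - γ`. -/
theorem sum_norm_inner_sq_le_energy {γ : H →L[ℂ] H} (he : Orthonormal ℂ e)
    (hγ : 0 ≤ γ) (hγ1 : γ ≤ 1) {F F' : Finset G} (hF : Disjoint F F') {ε : G → ℝ}
    (hε : ∀ n, 0 ≤ ε n) :
    ∑ p ∈ F ×ˢ F', (ε p.1 + ε p.2) * ∑ σ, ‖inner ℂ (e (p.1, σ)) (γ (e (p.2, σ)))‖ ^ 2 ≤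
      (∑ n ∈ F, ε n * ∑ σ, (inner ℂ (e (n, σ)) ((1 - γ) (e (n, σ)))).re) +
        ∑ n ∈ F', ε n * ∑ σ, (inner ℂ (e (n, σ)) (γ (e (n, σ)))).re := by
  have hδ : 0 ≤ 1 - γ := one_sub_nonneg_of_le_one hγ1
  have hδ1 : 1 - γ ≤ 1 := one_sub_le_one_of_nonneg hγ
  have he' : ∀ σ, Orthonormal ℂ fun n : G => e (n, σ) := fun σ =>
    he.comp (fun n => (n, σ)) fun a b h => congrArg Prod.fst h
  simp only [add_mul, Finset.sum_add_distrib]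
  refine add_le_add ?_ ?_
  · rw [Finset.sum_product]
    refine Finset.sum_le_sum fun n hn => ?_
    dsimp only
    rw [← Finset.mul_sum, Finset.sum_comm]
    refine mul_le_mul_of_nonneg_left (Finset.sum_le_sum fun σ _ => ?_) (hε n)
    refine le_trans ?_ (norm_apply_sq_le hδ hδ1 _)
    refine le_trans (Finset.sum_le_sum fun m hm => ?_)
      ((he' σ).sum_inner_products_le (s := F') ((1 - γ) (e (n, σ))))
    have hne : n ≠ m := fun h => (Finset.disjoint_left.1 hF hn) (h ▸ hm)
    have h0 : inner ℂ (e (n, σ)) (e (m, σ)) = 0 := (he' σ).2 hne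
    have h1 : inner ℂ (e (n, σ)) (γ (e (m, σ))) = -inner ℂ ((1 - γ) (e (n, σ))) (e (m, σ)) := by
      rw [inner_apply_comm hδ]
      simp [h0]
    rw [h1, norm_neg, norm_inner_symm]
  · rw [Finset.sum_product_right]
    refine Finset.sum_le_sum fun m hm => ?_
    dsimp only
    rw [← Finset.mul_sum, Finset.sum_comm]
    refine mul_le_mul_of_nonneg_left (Finset.sum_le_sum fun σ _ => ?_) (hε m)
    exact le_trans ((he' σ).sum_inner_products_le (s := F) (γ (e (m, σ)))) (norm_apply_sq_le hγ hγ1 _)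

omit [IsProbabilityMeasure P] in
/-- The density of `γ - N`, up to the modes in `S`, where `N` is the projection to the modes in
`F` (among those in `F ∪ F'`). -/
theorem abs_re_localDensity_sub_le [DecidableEq G] (hχ : IsCharacterFamily P χ)
    (he : Orthonormal ℂ e) {γ N : H →L[ℂ] H} (hγ : 0 ≤ γ) (hγ1 : γ ≤ 1) (hN : 0 ≤ N)
    (hN1 : N ≤ 1) {S F F' : Finset G} (hSF : Disjoint S F) (hSF' : Disjoint (S ∪ F) F')
    (hF : ∀ n ∈ F, ∀ σ, N (e (n, σ)) = e (n, σ)) (hF' : ∀ n ∈ F', ∀ σ, N (e (n, σ)) = 0) (x : X) :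
    |(localDensity χ e (γ - N) (S ∪ F ∪ F') (S ∪ F ∪ F') x).re| ≤
      3 * (Fintype.card ι * S.card) + 2 * (localDensity χ e γ F' F' x).re +
        2 * (localDensity χ e (1 - γ) F F x).re + 2 * ‖localDensity χ e γ F F' x‖ := by
  have h1 : |(localDensity χ e (γ - N) (S ∪ F ∪ F') (S ∪ F ∪ F') x).re -
      2 * (localDensity χ e γ F F' x).re| ≤
      3 * (Fintype.card ι * S.card) + 2 * (localDensity χ e γ F' F' x).re +
        2 * (localDensity χ e (1 - γ) F F x).re := by
    have hcard : (Fintype.card ι * S.card : ℝ) = ∑ σ : ι, ‖wavePacket χ e S x σ‖ ^ 2 := by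
      simp [norm_wavePacket_sq hχ he]
    rw [hcard]
    simp only [localDensity, Complex.re_sum, Finset.mul_sum, ← Finset.sum_add_distrib,
      ← Finset.sum_sub_distrib, wavePacket_union hSF', wavePacket_union hSF]
    refine (Finset.abs_sum_le_sum_abs _ _).trans (Finset.sum_le_sum fun σ _ => ?_)
    refine abs_re_inner_sub_le hγ hγ1 hN hN1 _ ?_ ?_
    · rw [wavePacket, map_sum]
      exact Finset.sum_eq_zero fun n hn => by rw [map_smul, hF' n hn, smul_zero]
    · rw [wavePacket, map_sum]
      exact Finset.sum_congr rfl fun n hn => by rw [map_smul, hF n hn]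
  have h2 := Complex.abs_re_le_norm (localDensity χ e γ F F' x)
  have h3 := abs_le.1 h1
  have h4 := abs_le.1 h2
  rw [abs_le]
  constructor <;> linarith [h3.1, h3.2, h4.1, h4.2]

end Characters

/-! ### The energy profile -/

/-- The function `t ↦ min (t² / R^(d-2)) t^(1 + 2/d)`. Up to constants and units it is the
semi-classical energy variation of a Fermi gas with Fermi momentum `R`. -/
def energyProfile (d : ℕ) (R t : ℝ) : ℝ := t * min (t / R ^ (d - 2)) (t ^ (2 / (d : ℝ)))

section Profile

variable {d : ℕ} {R : ℝ}

theorem min_profile_nonneg (hR : 0 < R) {t : ℝ} (ht : 0 ≤ t) :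
    0 ≤ min (t / R ^ (d - 2)) (t ^ (2 / (d : ℝ))) :=
  le_min (by positivity) (by positivity)

theorem energyProfile_nonneg (hR : 0 < R) {t : ℝ} (ht : 0 ≤ t) : 0 ≤ energyProfile d R t :=
  mul_nonneg ht (min_profile_nonneg hR ht)

theorem energyProfile_mono (hR : 0 < R) {s t : ℝ} (hs : 0 ≤ s) (hst : s ≤ t) :
    energyProfile d R s ≤ energyProfile d R t := by
  unfold energyProfile
  refine mul_le_mul hst (min_le_min ?_ ?_) (min_profile_nonneg hR hs) (hs.trans hst)
  · gcongr
  · exact Real.rpow_le_rpow hs hst (by positivity)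

theorem energyProfile_le_sq {t : ℝ} (ht : 0 ≤ t) :
    energyProfile d R t ≤ t ^ 2 / R ^ (d - 2) := by
  unfold energyProfile
  calc t * min (t / R ^ (d - 2)) (t ^ (2 / (d : ℝ))) ≤ t * (t / R ^ (d - 2)) := by
        gcongr
        exact min_le_left _ _
    _ = _ := by ring

theorem energyProfile_mul_le (hd : 2 ≤ d) {c t : ℝ} (hc : 1 ≤ c) (ht : 0 ≤ t) :
    energyProfile d R (c * t) ≤ c ^ 2 * energyProfile d R t := by
  have hd' : (2 : ℝ) ≤ d := by exact_mod_cast hd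
  have h1 : min (c * t / R ^ (d - 2)) ((c * t) ^ (2 / (d : ℝ))) ≤
      c * min (t / R ^ (d - 2)) (t ^ (2 / (d : ℝ))) := by
    rw [mul_min_of_nonneg _ _ (by linarith)]
    refine min_le_min (by rw [mul_div_assoc]) ?_
    rw [Real.mul_rpow (by linarith) ht]
    gcongr
    calc c ^ (2 / (d : ℝ)) ≤ c ^ (1 : ℝ) :=
          Real.rpow_le_rpow_of_exponent_le hc (by rw [div_le_one (by linarith)]; exact hd')
      _ = c := Real.rpow_one c
  unfold energyProfile
  calc c * t * min (c * t / R ^ (d - 2)) ((c * t) ^ (2 / (d : ℝ)))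
      ≤ c * t * (c * min (t / R ^ (d - 2)) (t ^ (2 / (d : ℝ)))) := by gcongr
    _ = _ := by ring

theorem continuous_energyProfile : Continuous (energyProfile d R) := by
  unfold energyProfile
  exact continuous_id.mul ((continuous_id.div_const _).min
    (Real.continuous_rpow_const (by positivity)))

theorem energyProfile_le_of_le (hd : 2 ≤ d) (hR : 0 < R) {t a b c : ℝ} (ht : 0 ≤ t)
    (ha : 0 ≤ a) (hb : 0 ≤ b) (hc : 0 ≤ c) (h : t ≤ 2 * a + 2 * b + 2 * c) :
    energyProfile d R t ≤
      36 * (energyProfile d R a + energyProfile d R b + energyProfile d R c) := by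
  have key : ∀ s, 0 ≤ s → t ≤ 6 * s → energyProfile d R t ≤ 36 * energyProfile d R s := by
    intro s hs h
    refine (energyProfile_mono hR ht h).trans ((energyProfile_mul_le hd (by norm_num) hs).trans ?_)
    norm_num
  have h1 := energyProfile_nonneg (d := d) hR ha
  have h2 := energyProfile_nonneg (d := d) hR hb
  have h3 := energyProfile_nonneg (d := d) hR hc
  have : t ≤ 6 * a ∨ t ≤ 6 * b ∨ t ≤ 6 * c := by
    by_contra! hcon
    linarith [hcon.1, hcon.2.1, hcon.2.2]
  rcases this with h | h | h
  · linarith [key a ha h]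
  · linarith [key b hb h]
  · linarith [key c hc h]

end Profile

/-! ### The inequality in units of the lattice spacing -/

section Lattice

variable {d q : ℕ} {X : Type*} [MeasurableSpace X] {P : Measure X} [IsProbabilityMeasure P]
  {χ : (Fin d → ℤ) → X → ℂ} {H : Type*} [NormedAddCommGroup H] [InnerProductSpace ℂ H]
  {e : (Fin d → ℤ) × Fin q → H}

/-- The density, in units of `R^(d-1)`, that has to be discarded in Rumin's inequality because a
thin shell still contains the lattice points near a sphere. -/
def ruminSlack (d q : ℕ) : ℝ := 4 * q * shellConst d

/-- The constant in Rumin's inequality for lattice modes. -/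
def ruminConst (d q : ℕ) : ℝ := 1 / (8 * (q + 1) * (shellConst d + 1))

theorem ruminConst_pos (hd : 2 ≤ d) : 0 < ruminConst d q := by
  have := shellConst_pos hd
  unfold ruminConst
  positivity

/-- Rumin's inequality combined with the lattice point count in shells. -/
theorem lintegral_energyProfile_le (hd : 2 ≤ d) (hχ : IsCharacterFamily P χ)
    (he : Orthonormal ℂ e) {M : ℝ} (hM : 0 ≤ M) {A : H →L[ℂ] H} (hA : 0 ≤ A) (hA1 : A ≤ 1)
    (F : Finset (Fin d → ℤ)) :
    ∫⁻ x, ENNReal.ofReal (energyProfile d (max 1 √M) (max ((localDensity χ e A F F x).re -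
        ruminSlack d q * max 1 √M ^ (d - 1)) 0)) ∂P ≤
      ENNReal.ofReal (4 / ruminConst d q * ∑ n ∈ F, |‖latticePoint n‖ ^ 2 - M| *
        ∑ σ, (inner ℂ (e (n, σ)) (A (e (n, σ)))).re) := by
  set R := max 1 √M with hRdef
  have hR1 : 1 ≤ R := le_max_left _ _
  have hR : 0 < R := by linarith
  set c := ruminConst d q with hc
  have hc0 : 0 < c := ruminConst_pos hd
  have hs := shellConst_pos hd
  have hd' : (0 : ℝ) < d := by exact_mod_cast (by omega : 0 < d)
  have hq0 : (0 : ℝ) ≤ q := Nat.cast_nonneg q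
  have hc8 : 8 * (q * shellConst d) * c ≤ 1 := by
    rw [hc, ruminConst, mul_one_div, div_le_one (by positivity)]
    nlinarith
  have hc1 : c ≤ 1 := by
    rw [hc, ruminConst, div_le_one (by positivity)]
    nlinarith [mul_nonneg hq0 hs.le]
  set t : X → ℝ := fun x => max ((localDensity χ e A F F x).re - ruminSlack d q * R ^ (d - 1)) 0
    with ht
  have ht0 : ∀ x, 0 ≤ t x := fun x => le_max_right _ _
  set E : X → ℝ := fun x => c * min (t x / R ^ (d - 2)) (t x ^ (2 / (d : ℝ))) with hE
  have hslack : 0 ≤ ruminSlack d q * R ^ (d - 1) := by unfold ruminSlack; positivity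
  have htα : ∀ x, t x ≤ (localDensity χ e A F F x).re := fun x =>
    max_le (by linarith) (re_localDensity_nonneg hA F x)
  have hrumin := lintegral_density_mul_le hχ he hA hA1 F
    (ε := fun n => |‖latticePoint n‖ ^ 2 - M|) (fun n => abs_nonneg _) E ?_
  · have hle : ∫⁻ x, ENNReal.ofReal (c / 4) * ENNReal.ofReal (energyProfile d R (t x)) ∂P ≤
        ∫⁻ x, ENNReal.ofReal ((localDensity χ e A F F x).re / 4 * E x) ∂P := by
      refine lintegral_mono fun x => ?_
      rw [← ENNReal.ofReal_mul (by positivity)]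
      apply ENNReal.ofReal_le_ofReal
      have h0 := min_profile_nonneg (d := d) hR (ht0 x)
      calc c / 4 * energyProfile d R (t x) = t x / 4 * E x := by
            simp only [energyProfile, hE]; ring
        _ ≤ _ := by
            have : 0 ≤ E x := mul_nonneg hc0.le h0
            have := htα x
            gcongr
    rw [lintegral_const_mul' _ _ ENNReal.ofReal_ne_top] at hle
    have h2 := hle.trans hrumin
    have h3 := mul_le_mul_right h2 (ENNReal.ofReal (4 / c))
    rw [← mul_assoc, ← ENNReal.ofReal_mul (by positivity), ← ENNReal.ofReal_mul (by positivity),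
      show 4 / c * (c / 4) = 1 by field_simp, ENNReal.ofReal_one, one_mul] at h3
    exact h3
  -- The shell of width `T` has `O(R^(d-2) T + T^(d/2) + R^(d-1))` modes. The cutoff `E` is chosen
  -- such that the first two terms are small compared to `t`; the slack absorbs the third.
  · intro x T hT0 hT
    have hmin : 0 < min (t x / R ^ (d - 2)) (t x ^ (2 / (d : ℝ))) := by
      by_contra hcon
      have : E x ≤ 0 := mul_nonpos_of_nonneg_of_nonpos hc0.le (not_lt.1 hcon)
      linarith
    have htpos : 0 < t x := by
      rcases (ht0 x).lt_or_eq with h | h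
      · exact h
      · rw [← h, zero_div] at hmin
        exact absurd (min_le_left _ _) (not_le.2 hmin)
    have hα : (localDensity χ e A F F x).re = t x + ruminSlack d q * R ^ (d - 1) := by
      have : t x = (localDensity χ e A F F x).re - ruminSlack d q * R ^ (d - 1) := by
        rcases le_total ((localDensity χ e A F F x).re - ruminSlack d q * R ^ (d - 1)) 0 with h | h
        · simp only [ht, max_eq_right h, lt_self_iff_false] at htpos
        · simp only [ht, max_eq_left h]
      linarith
    have hT1 : R ^ (d - 2) * T ≤ c * t x := by
      have : T ≤ c * (t x / R ^ (d - 2)) :=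
        hT.le.trans (mul_le_mul_of_nonneg_left (min_le_left _ _) hc0.le)
      calc R ^ (d - 2) * T ≤ R ^ (d - 2) * (c * (t x / R ^ (d - 2))) := by gcongr
        _ = _ := by field_simp
    have hT2 : √T ^ d ≤ c * t x := by
      have h1 : T ≤ c * t x ^ (2 / (d : ℝ)) :=
        hT.le.trans (mul_le_mul_of_nonneg_left (min_le_right _ _) hc0.le)
      have h2 : √T ^ d = T ^ ((d : ℝ) / 2) := by
        rw [Real.sqrt_eq_rpow, ← Real.rpow_natCast, ← Real.rpow_mul hT0.le]
        congr 1
        ring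
      rw [h2]
      calc T ^ ((d : ℝ) / 2) ≤ (c * t x ^ (2 / (d : ℝ))) ^ ((d : ℝ) / 2) :=
            Real.rpow_le_rpow hT0.le h1 (by positivity)
        _ = c ^ ((d : ℝ) / 2) * t x := by
            rw [Real.mul_rpow hc0.le (by positivity), ← Real.rpow_mul htpos.le,
              show 2 / (d : ℝ) * (d / 2) = 1 by field_simp, Real.rpow_one]
        _ ≤ c * t x := by
            gcongr
            calc c ^ ((d : ℝ) / 2) ≤ c ^ (1 : ℝ) := by
                  refine Real.rpow_le_rpow_of_exponent_ge hc0 hc1 ?_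
                  rw [le_div_iff₀ two_pos, one_mul]
                  exact_mod_cast hd
              _ = c := Real.rpow_one c
    have hcard := card_shell_le hd hM hT0.le (F.filter fun n => |‖latticePoint n‖ ^ 2 - M| ≤ T)
      (fun n hn => (Finset.mem_filter.1 hn).2)
    rw [← hRdef] at hcard
    rw [Fintype.card_fin, hα]
    calc 4 * (q * ((F.filter fun n => |‖latticePoint n‖ ^ 2 - M| ≤ T).card : ℝ))
        ≤ 4 * (q * (shellConst d * (c * t x + c * t x + R ^ (d - 1)))) := by
          gcongr
          exact hcard.trans (by gcongr)
      _ = 8 * (q * shellConst d) * c * t x + ruminSlack d q * R ^ (d - 1) := by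
          unfold ruminSlack; ring
      _ ≤ _ := by nlinarith

/-- The constant in the off-diagonal bound. -/
def lindhardConst (d : ℕ) : ℝ := 2 * (ballVolume (d - 1) * (d - 1 : ℕ) * Real.pi)

theorem lindhardConst_nonneg (d : ℕ) : 0 ≤ lindhardConst d := by
  have := ballVolume_pos (d - 1)
  have := Real.pi_pos
  unfold lindhardConst
  positivity

/-- The density of the off-diagonal part of `γ`, away from the Fermi surface. This is the step that
needs `d ≥ 2`: in one dimension the sum of the inverse weights over pairs of modes with a given
difference is larger by a logarithm. -/
theorem lintegral_energyProfile_offDiagonal_le (hd : 2 ≤ d) (hχ : IsCharacterFamily P χ)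
    (he : Orthonormal ℂ e) {M : ℝ} {γ : H →L[ℂ] H} (hγ : 0 ≤ γ) (hγ1 : γ ≤ 1)
    {F F' : Finset (Fin d → ℤ)}
    (hF : ∀ n ∈ F, ‖latticePoint n‖ ^ 2 + 8 * d ^ 2 * max 1 √M < M)
    (hF' : ∀ n ∈ F', M + 8 * d ^ 2 * max 1 √M < ‖latticePoint n‖ ^ 2) :
    ∫⁻ x, ENNReal.ofReal (energyProfile d (max 1 √M) ‖localDensity χ e γ F F' x‖) ∂P ≤
      ENNReal.ofReal (lindhardConst d * q *
        ((∑ n ∈ F, |‖latticePoint n‖ ^ 2 - M| *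
          ∑ σ, (inner ℂ (e (n, σ)) ((1 - γ) (e (n, σ)))).re) +
        ∑ n ∈ F', |‖latticePoint n‖ ^ 2 - M| *
          ∑ σ, (inner ℂ (e (n, σ)) (γ (e (n, σ)))).re)) := by
  set R := max 1 √M with hRdef
  have hR1 : 1 ≤ R := le_max_left _ _
  have hR : 0 < R := by linarith
  have hd' : (2 : ℝ) ≤ d := by exact_mod_cast hd
  have hW : 0 < 8 * (d : ℝ) ^ 2 * R := by positivity
  have hdis : Disjoint F F' := by
    rw [Finset.disjoint_left]
    intro n hn hn'
    linarith [hF n hn, hF' n hn']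
  have hMR : F.Nonempty → R ^ 2 = M := by
    rintro ⟨n, hn⟩
    have h1 := hF n hn
    have h2 : 1 ≤ M := by nlinarith [sq_nonneg ‖latticePoint n‖]
    rw [hRdef, max_eq_right (by rw [Real.le_sqrt' one_pos]; linarith), Real.sq_sqrt (by linarith)]
  have h1 := integral_norm_localDensity_sq_le (e := e) hχ γ F F'
    (w := fun p => |‖latticePoint p.1‖ ^ 2 - M| + |‖latticePoint p.2‖ ^ 2 - M|)
    (Φ := lindhardConst d * R ^ (d - 2)) ?_ ?_
  · have h2 := sum_norm_inner_sq_le_energy (F := F) (F' := F') he hγ hγ1 hdis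
      (ε := fun n => |‖latticePoint n‖ ^ 2 - M|) (fun n => abs_nonneg _)
    have hRp : 0 < R ^ (d - 2) := by positivity
    have hl := lindhardConst_nonneg d
    rw [Fintype.card_fin] at h1
    have hint : Integrable (fun x => ‖localDensity χ e γ F F' x‖ ^ 2 / R ^ (d - 2)) P := by
      refine Integrable.div_const ?_ _
      have : ∃ C, ∀ x, ‖localDensity χ e γ F F' x‖ ≤ C := by
        refine ⟨∑ n ∈ F, ∑ m ∈ F', ‖∑ σ, inner ℂ (e (n, σ)) (γ (e (m, σ)))‖, fun x => ?_⟩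
        rw [localDensity_eq_sum hχ]
        refine (norm_sum_le _ _).trans (Finset.sum_le_sum fun n _ => (norm_sum_le _ _).trans
          (Finset.sum_le_sum fun m _ => ?_))
        rw [norm_mul, hχ.norm_eq_one, mul_one]
      obtain ⟨C, hC⟩ := this
      refine Integrable.of_bound ((measurable_localDensity hχ γ F F').norm.pow_const
        2).aestronglyMeasurable (C ^ 2) (Filter.Eventually.of_forall fun x => ?_)
      rw [Real.norm_eq_abs, abs_of_nonneg (sq_nonneg _)]
      exact pow_le_pow_left₀ (norm_nonneg _) (hC x) 2
    calc _ ≤ ∫⁻ x, ENNReal.ofReal (‖localDensity χ e γ F F' x‖ ^ 2 / R ^ (d - 2)) ∂P :=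
          lintegral_mono fun x => ENNReal.ofReal_le_ofReal
            (energyProfile_le_sq (norm_nonneg _))
      _ = ENNReal.ofReal ((∫ x, ‖localDensity χ e γ F F' x‖ ^ 2 ∂P) / R ^ (d - 2)) := by
          rw [← ofReal_integral_eq_lintegral_ofReal hint
            (Filter.Eventually.of_forall fun x => by positivity), integral_div]
      _ ≤ _ := by
          apply ENNReal.ofReal_le_ofReal
          rw [div_le_iff₀ hRp]
          refine h1.trans ?_
          refine (mul_le_mul_of_nonneg_left (mul_le_mul_of_nonneg_left h2 (Nat.cast_nonneg q))
            (mul_nonneg hl hRp.le)).trans_eq ?_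
          ring
  · intro p hp
    have h3 := hF' p.2 (Finset.mem_product.1 hp).2
    have h4 : 0 < |‖latticePoint p.2‖ ^ 2 - M| := abs_pos.2 (by linarith)
    positivity
  -- The surface separates `F` from `F'`, so the weight of a pair is the difference of the two
  -- energies, which does not involve `M`.
  · intro k
    have hsum : ∑ p ∈ F ×ˢ F' with p.1 - p.2 = k,
        1 / (|‖latticePoint p.1‖ ^ 2 - M| + |‖latticePoint p.2‖ ^ 2 - M|) =
        ∑ n ∈ F with n - k ∈ F', 1 / (‖latticePoint (n - k)‖ ^ 2 - ‖latticePoint n‖ ^ 2) := by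
      refine Finset.sum_bij' (fun p _ => p.1) (fun n _ => (n, n - k)) ?_ ?_ ?_ ?_ ?_
      · intro p hp
        obtain ⟨hp1, rfl⟩ := Finset.mem_filter.1 hp
        rw [Finset.mem_product] at hp1
        simpa using hp1
      · intro n hn
        simpa using hn
      · intro p hp
        obtain ⟨hp1, rfl⟩ := Finset.mem_filter.1 hp
        simp
      · intro n hn
        rfl
      · intro p hp
        obtain ⟨hp1, rfl⟩ := Finset.mem_filter.1 hp
        rw [Finset.mem_product] at hp1
        have h3 := hF _ hp1.1
        have h4 := hF' _ hp1.2
        rw [sub_sub_cancel, abs_of_neg (by linarith), abs_of_pos (by linarith)]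
        ring_nf
    rw [hsum]
    rcases F.eq_empty_or_nonempty with h0 | h0
    · rw [h0, Finset.filter_empty, Finset.sum_empty]
      exact mul_nonneg (lindhardConst_nonneg d) (by positivity)
    · have hM := hMR h0
      refine (sum_lindhard_le hd hR1 k _ (fun n hn => ?_) (fun n hn => ?_)).trans_eq ?_
      · rw [hM]; exact hF n (Finset.mem_filter.1 hn).1
      · rw [hM]; exact hF' _ (Finset.mem_filter.1 hn).2
      · unfold lindhardConst; ring

end Lattice

/-! ### The kinetic energy of finitely many modes -/

section Lattice

variable {d q : ℕ} {X : Type*} [MeasurableSpace X] {P : Measure X} [IsProbabilityMeasure P]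
  {χ : (Fin d → ℤ) → X → ℂ} {H : Type*} [NormedAddCommGroup H] [InnerProductSpace ℂ H]
  {e : (Fin d → ℤ) × Fin q → H}

/-- A bound for the number of frequencies near the Fermi surface, in units of `R^(d-1)`. -/
def fermiShellConst (d : ℕ) : ℝ :=
  shellConst d * (8 * d ^ 2 + √(8 * d ^ 2) ^ d + 1)

theorem card_fermiShell_le (hd : 2 ≤ d) {M : ℝ} (hM : 0 ≤ M) (S : Finset (Fin d → ℤ))
    (hS : ∀ n ∈ S, |‖latticePoint n‖ ^ 2 - M| ≤ 8 * d ^ 2 * max 1 √M) :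
    (S.card : ℝ) ≤ fermiShellConst d * max 1 √M ^ (d - 1) := by
  set R := max 1 √M with hRdef
  have hR1 : 1 ≤ R := le_max_left _ _
  have hR : 0 < R := by linarith
  have hs := shellConst_pos hd
  refine (card_shell_le hd hM (by positivity) S hS).trans ?_
  rw [← hRdef]
  have h1 : R ^ (d - 2) * (8 * d ^ 2 * R) = 8 * d ^ 2 * R ^ (d - 1) := by
    rw [show d - 1 = (d - 2) + 1 by omega, pow_succ]
    ring
  have h2 : √(8 * d ^ 2 * R) ^ d ≤ √(8 * d ^ 2) ^ d * R ^ (d - 1) := by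
    rw [Real.sqrt_mul (by positivity), mul_pow]
    gcongr
    have hsq : √R ^ 2 = R := Real.sq_sqrt hR.le
    calc √R ^ d ≤ √R ^ (2 * (d - 1)) :=
          pow_le_pow_right₀ (by rw [Real.le_sqrt' one_pos]; linarith) (by omega)
      _ = R ^ (d - 1) := by rw [pow_mul, hsq]
  rw [h1, fermiShellConst, mul_assoc (shellConst d)]
  refine mul_le_mul_of_nonneg_left ?_ hs.le
  linarith

/-- The part of the density that the inequality does not see, in units of `R^(d-1)`: the modes near
the Fermi surface, and the slack in Rumin's inequality for the two diagonal parts. -/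
def densitySlack (d q : ℕ) : ℝ := 3 * (q * fermiShellConst d) + 4 * ruminSlack d q

theorem densitySlack_nonneg (hd : 2 ≤ d) : 0 ≤ densitySlack d q := by
  have := shellConst_pos hd
  unfold densitySlack fermiShellConst ruminSlack
  positivity

/-- The inverse of the constant in the Lieb-Thirring inequality. -/
def energyConst (d q : ℕ) : ℝ := 36 * (8 / ruminConst d q + lindhardConst d * q)

theorem energyConst_pos (hd : 2 ≤ d) : 0 < energyConst d q := by
  have := ruminConst_pos (q := q) hd
  have := lindhardConst_nonneg d
  unfold energyConst
  positivity

/-- The kinetic energy of a finite set of modes controls the energy of the modes above and below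
the Fermi surface, measured from the Fermi surface. -/
theorem energy_parts_le {M : ℝ} {γ N : H →L[ℂ] H} (hγ : 0 ≤ γ) (hγ1 : γ ≤ 1)
    (hN1 : ∀ n σ, ‖latticePoint n‖ ^ 2 ≤ M → N (e (n, σ)) = e (n, σ))
    (hN0 : ∀ n σ, M < ‖latticePoint n‖ ^ 2 → N (e (n, σ)) = 0)
    {F F₁ F₂ : Finset (Fin d → ℤ)} (h1 : F₁ ⊆ F) (h2 : F₂ ⊆ F)
    (hF₁ : ∀ n ∈ F₁, ‖latticePoint n‖ ^ 2 ≤ M) (hF₂ : ∀ n ∈ F₂, M < ‖latticePoint n‖ ^ 2) :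
    (∑ n ∈ F₁, |‖latticePoint n‖ ^ 2 - M| *
        ∑ σ, (inner ℂ (e (n, σ)) ((1 - γ) (e (n, σ)))).re) +
      ∑ n ∈ F₂, |‖latticePoint n‖ ^ 2 - M| * ∑ σ, (inner ℂ (e (n, σ)) (γ (e (n, σ)))).re ≤
    ∑ n ∈ F, (‖latticePoint n‖ ^ 2 - M) *
      ∑ σ, (inner ℂ (e (n, σ)) ((γ - N) (e (n, σ)))).re := by
  classical
  have key1 : ∀ n, ‖latticePoint n‖ ^ 2 ≤ M → (‖latticePoint n‖ ^ 2 - M) *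
      ∑ σ, (inner ℂ (e (n, σ)) ((γ - N) (e (n, σ)))).re = |‖latticePoint n‖ ^ 2 - M| *
        ∑ σ, (inner ℂ (e (n, σ)) ((1 - γ) (e (n, σ)))).re := by
    intro n hn
    rw [abs_of_nonpos (by linarith), neg_mul, ← mul_neg, ← Finset.sum_neg_distrib]
    congr 1
    refine Finset.sum_congr rfl fun σ _ => ?_
    rw [← Complex.neg_re, ← inner_neg_right, sub_apply, sub_apply, one_apply_eq_self, neg_sub,
      hN1 n σ hn]
  have key2 : ∀ n, M < ‖latticePoint n‖ ^ 2 → (‖latticePoint n‖ ^ 2 - M) *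
      ∑ σ, (inner ℂ (e (n, σ)) ((γ - N) (e (n, σ)))).re = |‖latticePoint n‖ ^ 2 - M| *
        ∑ σ, (inner ℂ (e (n, σ)) (γ (e (n, σ)))).re := by
    intro n hn
    rw [abs_of_pos (by linarith)]
    congr 1
    refine Finset.sum_congr rfl fun σ _ => ?_
    simp [hN0 n σ hn]
  have hδ := one_sub_nonneg_of_le_one hγ1
  have hdis : Disjoint F₁ F₂ := by
    rw [Finset.disjoint_left]
    intro n hn hn'
    linarith [hF₁ n hn, hF₂ n hn']
  rw [← Finset.sum_congr rfl fun n hn => key1 n (hF₁ n hn),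
    ← Finset.sum_congr rfl fun n hn => key2 n (hF₂ n hn), ← Finset.sum_union hdis]
  refine Finset.sum_le_sum_of_subset_of_nonneg (Finset.union_subset h1 h2) fun n _ _ => ?_
  rcases le_or_gt (‖latticePoint n‖ ^ 2) M with h | h
  · rw [key1 n h]
    exact mul_nonneg (abs_nonneg _) (Finset.sum_nonneg fun σ _ => re_inner_apply_nonneg hδ _)
  · rw [key2 n h]
    exact mul_nonneg (abs_nonneg _) (Finset.sum_nonneg fun σ _ => re_inner_apply_nonneg hγ _)

/-- The Lieb-Thirring inequality at positive density for finitely many modes, in units of the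
lattice spacing. -/
theorem lintegral_energyProfile_density_le (hd : 2 ≤ d) (hχ : IsCharacterFamily P χ)
    (he : Orthonormal ℂ e) {M : ℝ} (hM : 0 ≤ M) {γ N : H →L[ℂ] H} (hγ : 0 ≤ γ)
    (hγ1 : γ ≤ 1) (hN : 0 ≤ N) (hN' : N ≤ 1)
    (hN1 : ∀ n σ, ‖latticePoint n‖ ^ 2 ≤ M → N (e (n, σ)) = e (n, σ))
    (hN0 : ∀ n σ, M < ‖latticePoint n‖ ^ 2 → N (e (n, σ)) = 0) (F : Finset (Fin d → ℤ)) :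
    ∫⁻ x, ENNReal.ofReal (energyProfile d (max 1 √M)
        (max (|(localDensity χ e (γ - N) F F x).re| -
          densitySlack d q * max 1 √M ^ (d - 1)) 0)) ∂P ≤
      ENNReal.ofReal (energyConst d q * ∑ n ∈ F, (‖latticePoint n‖ ^ 2 - M) *
        ∑ σ, (inner ℂ (e (n, σ)) ((γ - N) (e (n, σ)))).re) := by
  classical
  have hδ := one_sub_nonneg_of_le_one hγ1
  have hδ1 := one_sub_le_one_of_nonneg hγ
  set R := max 1 √M with hRdef
  have hR1 : 1 ≤ R := le_max_left _ _
  have hR : 0 < R := by linarith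
  -- `S` collects the modes near the Fermi surface, `F₁` those inside and `F₂` those outside. The
  -- width `W` is the one that makes the lattice sum in the off-diagonal bound comparable with an
  -- integral, and is small enough for `S` to have only `O(R^(d-1))` elements.
  set W := 8 * (d : ℝ) ^ 2 * R with hW
  have hW0 : 0 ≤ W := by positivity
  set S := F.filter fun n => |‖latticePoint n‖ ^ 2 - M| ≤ W with hS
  set F₁ := F.filter fun n => ‖latticePoint n‖ ^ 2 + W < M with hF₁
  set F₂ := F.filter fun n => M + W < ‖latticePoint n‖ ^ 2 with hF₂
  have mS : ∀ n ∈ S, |‖latticePoint n‖ ^ 2 - M| ≤ W := fun n hn => (Finset.mem_filter.1 hn).2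
  have m1 : ∀ n ∈ F₁, ‖latticePoint n‖ ^ 2 + W < M := fun n hn => (Finset.mem_filter.1 hn).2
  have m2 : ∀ n ∈ F₂, M + W < ‖latticePoint n‖ ^ 2 := fun n hn => (Finset.mem_filter.1 hn).2
  have d1 : Disjoint S F₁ := by
    rw [Finset.disjoint_left]
    intro n hn hn'
    linarith [(abs_le.1 (mS n hn)).1, m1 n hn']
  have d2 : Disjoint (S ∪ F₁) F₂ := by
    rw [Finset.disjoint_left]
    intro n hn hn'
    rcases Finset.mem_union.1 hn with h | h
    · linarith [(abs_le.1 (mS n h)).2, m2 n hn']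
    · linarith [m1 n h, m2 n hn']
  have hun : S ∪ F₁ ∪ F₂ = F := by
    ext n
    simp only [hS, hF₁, hF₂, Finset.mem_union, Finset.mem_filter, ← and_or_left,
      and_iff_left_iff_imp]
    intro _
    by_contra! hcon
    obtain ⟨⟨c1, c2⟩, c3⟩ := hcon
    rcases lt_abs.1 c1 with h | h <;> linarith
  set E₁ := ∑ n ∈ F₁, |‖latticePoint n‖ ^ 2 - M| *
    ∑ σ, (inner ℂ (e (n, σ)) ((1 - γ) (e (n, σ)))).re with hE₁
  set E₂ := ∑ n ∈ F₂, |‖latticePoint n‖ ^ 2 - M| *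
    ∑ σ, (inner ℂ (e (n, σ)) (γ (e (n, σ)))).re with hE₂
  have hE₁0 : 0 ≤ E₁ := Finset.sum_nonneg fun n _ => mul_nonneg (abs_nonneg _)
    (Finset.sum_nonneg fun σ _ => re_inner_apply_nonneg hδ _)
  have hE₂0 : 0 ≤ E₂ := Finset.sum_nonneg fun n _ => mul_nonneg (abs_nonneg _)
    (Finset.sum_nonneg fun σ _ => re_inner_apply_nonneg hγ _)
  have hE := energy_parts_le hγ hγ1 hN1 hN0 (Finset.filter_subset _ F : F₁ ⊆ F)
    (Finset.filter_subset _ F : F₂ ⊆ F) (fun n hn => by linarith [m1 n hn])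
    (fun n hn => by linarith [m2 n hn])
  have i1 := lintegral_energyProfile_le hd hχ he hM hδ hδ1 F₁
  have i2 := lintegral_energyProfile_le hd hχ he hM hγ hγ1 F₂
  have i3 := lintegral_energyProfile_offDiagonal_le hd hχ he hγ hγ1 m1 m2
  rw [← hRdef] at i1 i2 i3
  have hcard := card_fermiShell_le hd hM S mS
  rw [← hRdef] at hcard
  set a : X → ℝ := fun x =>
    max ((localDensity χ e (1 - γ) F₁ F₁ x).re - ruminSlack d q * R ^ (d - 1)) 0 with ha
  set b : X → ℝ := fun x =>
    max ((localDensity χ e γ F₂ F₂ x).re - ruminSlack d q * R ^ (d - 1)) 0 with hb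
  set w : X → ℝ := fun x => ‖localDensity χ e γ F₁ F₂ x‖ with hw
  have hpt : ∀ x, energyProfile d R (max (|(localDensity χ e (γ - N) F F x).re| -
      densitySlack d q * R ^ (d - 1)) 0) ≤
      36 * (energyProfile d R (a x) + energyProfile d R (b x) + energyProfile d R (w x)) := by
    intro x
    have h := abs_re_localDensity_sub_le hχ he hγ hγ1 hN hN' d1 d2
      (fun n hn σ => hN1 n σ (by linarith [m1 n hn]))
      (fun n hn σ => hN0 n σ (by linarith [m2 n hn])) x
    rw [hun, Fintype.card_fin] at h
    have ha0 : 0 ≤ a x := le_max_right _ _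
    have hb0 : 0 ≤ b x := le_max_right _ _
    have hw0 : 0 ≤ w x := norm_nonneg _
    have ha1 : (localDensity χ e (1 - γ) F₁ F₁ x).re - ruminSlack d q * R ^ (d - 1) ≤ a x :=
      le_max_left _ _
    have hb1 : (localDensity χ e γ F₂ F₂ x).re - ruminSlack d q * R ^ (d - 1) ≤ b x :=
      le_max_left _ _
    have hq : (q : ℝ) * S.card ≤ q * (fermiShellConst d * R ^ (d - 1)) := by gcongr
    refine energyProfile_le_of_le hd hR (le_max_right _ _) ha0 hb0 hw0 (max_le ?_ (by positivity))
    have hexp : densitySlack d q * R ^ (d - 1) = 3 * (q * (fermiShellConst d * R ^ (d - 1))) +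
        4 * (ruminSlack d q * R ^ (d - 1)) := by unfold densitySlack; ring
    have hwx : w x = ‖localDensity χ e γ F₁ F₂ x‖ := rfl
    linarith
  have hc := ruminConst_pos (q := q) hd
  have hl := lindhardConst_nonneg d
  have mb : Measurable fun x => ENNReal.ofReal (energyProfile d R (b x)) :=
    (continuous_energyProfile.measurable.comp (((Complex.measurable_re.comp
      (measurable_localDensity hχ _ _ _)).sub_const _).max measurable_const)).ennreal_ofReal
  have mw : Measurable fun x => ENNReal.ofReal (energyProfile d R (w x)) :=
    (continuous_energyProfile.measurable.comp (measurable_localDensity hχ _ _ _).norm).ennreal_ofReal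
  calc _ ≤ ∫⁻ x, ENNReal.ofReal 36 * (ENNReal.ofReal (energyProfile d R (a x)) +
        ENNReal.ofReal (energyProfile d R (b x)) + ENNReal.ofReal (energyProfile d R (w x))) ∂P := by
        refine lintegral_mono fun x => ?_
        have ha0 : 0 ≤ energyProfile d R (a x) := energyProfile_nonneg hR (le_max_right _ _)
        have hb0 : 0 ≤ energyProfile d R (b x) := energyProfile_nonneg hR (le_max_right _ _)
        have hw0 : 0 ≤ energyProfile d R (w x) := energyProfile_nonneg hR (norm_nonneg _)
        rw [← ENNReal.ofReal_add ha0 hb0, ← ENNReal.ofReal_add (add_nonneg ha0 hb0) hw0,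
          ← ENNReal.ofReal_mul (by norm_num)]
        exact ENNReal.ofReal_le_ofReal (hpt x)
    _ = ENNReal.ofReal 36 * ((∫⁻ x, ENNReal.ofReal (energyProfile d R (a x)) ∂P) +
        (∫⁻ x, ENNReal.ofReal (energyProfile d R (b x)) ∂P) +
        ∫⁻ x, ENNReal.ofReal (energyProfile d R (w x)) ∂P) := by
        rw [lintegral_const_mul' _ _ ENNReal.ofReal_ne_top, lintegral_add_right _ mw,
          lintegral_add_right _ mb]
    _ ≤ ENNReal.ofReal 36 * (ENNReal.ofReal (4 / ruminConst d q * E₁) +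
        ENNReal.ofReal (4 / ruminConst d q * E₂) +
        ENNReal.ofReal (lindhardConst d * q * (E₁ + E₂))) := by gcongr
    _ = ENNReal.ofReal (36 * (4 / ruminConst d q * E₁ + 4 / ruminConst d q * E₂ +
        lindhardConst d * q * (E₁ + E₂))) := by
        rw [← ENNReal.ofReal_add (by positivity) (by positivity),
          ← ENNReal.ofReal_add (by positivity) (by positivity), ← ENNReal.ofReal_mul (by norm_num)]
    _ ≤ _ := by
        apply ENNReal.ofReal_le_ofReal
        refine le_trans ?_ (mul_le_mul_of_nonneg_left hE (energyConst_pos hd).le)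
        have : 0 ≤ 4 / ruminConst d q * (E₁ + E₂) := by positivity
        have e8 : 8 / ruminConst d q = 2 * (4 / ruminConst d q) := by ring
        rw [energyConst, e8]
        linarith

end Lattice

/-! ### Plane waves on the box -/

/-- The scalar exponential `x ↦ e^{2πi n·x/L}`. -/
def boxCharacter {d : ℕ} (L : ℝ) (n : Fin d → ℤ) (x : Fin d → ℝ) : ℂ :=
  Complex.exp (((∑ i, (2 * Real.pi * (n i : ℝ) / L) * x i : ℝ) : ℂ) * Complex.I)

/-- The uniform probability measure on the box. -/
def boxProb (d : ℕ) (L : ℝ) : Measure (Fin d → ℝ) :=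
  ENNReal.ofReal L⁻¹ ^ d • PeriodicBox.cubeMeasure d L

/-- The covering map from the box of side `L` to the unit torus. -/
def boxToTorus {d : ℕ} (L : ℝ) (x : Fin d → ℝ) : UnitAddTorus (Fin d) :=
  fun i => ((L⁻¹ * x i : ℝ) : UnitAddCircle)

/-- The inverse of the covering map, with values in the box. -/
def torusToBox {d : ℕ} (L : ℝ) (t : UnitAddTorus (Fin d)) : Fin d → ℝ :=
  fun i => L * (AddCircle.measurableEquivIco 1 (-(1 / 2)) (t i) : ℝ)

theorem measurable_torusToBox {d : ℕ} (L : ℝ) : Measurable (torusToBox (d := d) L) := by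
  refine measurable_pi_lambda _ fun i => Measurable.const_mul ?_ L
  exact measurable_subtype_coe.comp
    ((AddCircle.measurableEquivIco 1 (-(1 / 2))).measurable.comp (measurable_pi_apply i))

theorem torusToBox_boxToTorus {d : ℕ} {L : ℝ} (hL : 0 < L) {x : Fin d → ℝ}
    (hx : x ∈ PeriodicBox.cube d L) : torusToBox L (boxToTorus L x) = x := by
  ext i
  have hi := hx i (Set.mem_univ i)
  have hmem : L⁻¹ * x i ∈ Set.Ico (-(1 / 2) : ℝ) (-(1 / 2) + 1) := by
    rw [inv_mul_eq_div, Set.mem_Ico, le_div_iff₀ hL, div_lt_iff₀ hL]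
    constructor <;> linarith [hi.1, hi.2]
  have h : (AddCircle.measurableEquivIco 1 (-(1 / 2)) ((L⁻¹ * x i : ℝ) : UnitAddCircle) : ℝ) =
      L⁻¹ * x i := AddCircle.equivIco_coe_of_mem hmem
  simp only [torusToBox, boxToTorus]
  rw [h, mul_inv_cancel_left₀ hL.ne']

theorem boxProb_eq_pi (d : ℕ) (L : ℝ) : boxProb d L = Measure.pi fun _ : Fin d =>
    ENNReal.ofReal L⁻¹ • (volume : Measure ℝ).restrict (Set.Ico (-(L / 2)) (L / 2)) := by
  symm
  have : ∀ _ : Fin d, IsFiniteMeasure (ENNReal.ofReal L⁻¹ •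
      (volume : Measure ℝ).restrict (Set.Ico (-(L / 2)) (L / 2))) := fun _ =>
    Measure.smul_finite _ ENNReal.ofReal_ne_top
  refine Measure.pi_eq fun s _ => ?_
  rw [boxProb, PeriodicBox.cubeMeasure, PeriodicBox.cube, volume_pi, Measure.restrict_pi_pi,
    Measure.smul_apply, Measure.pi_pi]
  simp only [Measure.smul_apply, smul_eq_mul, Finset.prod_mul_distrib, Finset.prod_const,
    Finset.card_univ, Fintype.card_fin]

theorem measurePreserving_boxToTorus (d : ℕ) {L : ℝ} (hL : 0 < L) :
    MeasurePreserving (boxToTorus L) (boxProb d L)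
      (Measure.pi fun _ : Fin d => (AddCircle.haarAddCircle : Measure UnitAddCircle)) := by
  rw [boxProb_eq_pi]
  refine measurePreserving_pi _ _ (f := fun _ (y : ℝ) => ((L⁻¹ * y : ℝ) : UnitAddCircle))
    fun _ => ?_
  have h1 : MeasurePreserving (fun y : ℝ => L⁻¹ * y) (ENNReal.ofReal L⁻¹ • volume) volume := by
    refine ⟨by fun_prop, ?_⟩
    have h := Real.smul_map_volume_mul_left (inv_ne_zero hL.ne')
    rwa [abs_of_pos (inv_pos.2 hL), ← Measure.map_smul] at h
  have h2 := h1.restrict_preimage (s := Set.Ico (-(1 / 2) : ℝ) (-(1 / 2) + 1)) measurableSet_Ico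
  have hpre : (fun y : ℝ => L⁻¹ * y) ⁻¹' Set.Ico (-(1 / 2) : ℝ) (-(1 / 2) + 1) =
      Set.Ico (-(L / 2)) (L / 2) := by
    ext y
    simp only [Set.mem_preimage, Set.mem_Ico, inv_mul_eq_div, le_div_iff₀ hL, div_lt_iff₀ hL]
    constructor <;> rintro ⟨a, b⟩ <;> constructor <;> linarith
  rw [hpre, Measure.restrict_smul] at h2
  have h3 := AddCircle.measurePreserving_mk (1 : ℝ) (-(1 / 2))
  rw [← Measure.restrict_congr_set (Ico_ae_eq_Ioc' (by simp) (by simp)),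
    AddCircle.volume_eq_smul_haarAddCircle, ENNReal.ofReal_one, one_smul] at h3
  exact h3.comp h2

theorem isProbabilityMeasure_boxProb (d : ℕ) {L : ℝ} (hL : 0 < L) :
    IsProbabilityMeasure (boxProb d L) :=
  ⟨by simpa using (measurePreserving_boxToTorus d hL).measure_preimage nullMeasurableSet_univ⟩

theorem boxCharacter_eq_mFourier {d : ℕ} (L : ℝ) (n : Fin d → ℤ) (x : Fin d → ℝ) :
    boxCharacter L n x = UnitAddTorus.mFourier n (boxToTorus L x) := by
  change _ = ∏ i, fourier (n i) ((L⁻¹ * x i : ℝ) : UnitAddCircle)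
  simp only [fourier_coe_apply]
  rw [boxCharacter, ← Complex.exp_sum]
  congr 1
  push_cast
  rw [Finset.sum_mul]
  refine Finset.sum_congr rfl fun i _ => ?_
  ring

theorem norm_boxCharacter {d : ℕ} (L : ℝ) (n : Fin d → ℤ) (x : Fin d → ℝ) :
    ‖boxCharacter L n x‖ = 1 := Complex.norm_exp_ofReal_mul_I _

theorem continuous_boxCharacter {d : ℕ} (L : ℝ) (n : Fin d → ℤ) :
    Continuous (boxCharacter L n) := by
  unfold boxCharacter
  fun_prop

theorem isCharacterFamily_boxCharacter (d : ℕ) {L : ℝ} (hL : 0 < L) :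
    IsCharacterFamily (boxProb d L) (boxCharacter (d := d) L) where
  measurable n := (continuous_boxCharacter L n).measurable
  norm_eq_one := norm_boxCharacter L
  sub n m x := by
    simp only [boxCharacter_eq_mFourier, ← UnitAddTorus.mFourier_neg, sub_eq_add_neg]
    exact UnitAddTorus.mFourier_add
  integral_eq_zero n hn := by
    have hmp := measurePreserving_boxToTorus d hL
    simp only [boxCharacter_eq_mFourier]
    rw [← integral_map hmp.measurable.aemeasurable
      (UnitAddTorus.mFourier n).continuous.aestronglyMeasurable, hmp.map_eq]
    have h : inner ℂ (UnitAddTorus.mFourierLp 2 0) (UnitAddTorus.mFourierLp 2 n) = 0 :=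
      UnitAddTorus.orthonormal_mFourier.2 (Ne.symm hn)
    rw [ContinuousMap.inner_toLp] at h
    simpa [UnitAddTorus.mFourier_zero] using! h

theorem planeWaveFun_eq {d q : ℕ} (L : ℝ) (n : Fin d → ℤ) (σ : Fin q) (x : Fin d → ℝ) :
    PeriodicBox.planeWaveFun L n σ x =
      ((((√(L ^ d))⁻¹ : ℝ) : ℂ) * boxCharacter L n x) • EuclideanSpace.single σ (1 : ℂ) := rfl

theorem integral_cubeMeasure_eq {d : ℕ} {L : ℝ} (hL : 0 < L) (f : (Fin d → ℝ) → ℂ) :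
    ∫ x, f x ∂PeriodicBox.cubeMeasure d L = ((L ^ d : ℝ) : ℂ) * ∫ x, f x ∂boxProb d L := by
  rw [boxProb, integral_smul_measure, ENNReal.toReal_pow, ENNReal.toReal_ofReal (by positivity),
    Complex.real_smul, ← mul_assoc, ← Complex.ofReal_mul, inv_pow,
    mul_inv_cancel₀ (pow_pos hL d).ne', Complex.ofReal_one, one_mul]

theorem inner_planeWave {d q : ℕ} (L : ℝ) (n : Fin d → ℤ) (σ : Fin q)
    (f : PeriodicBox.BoxL2 d q L) :
    inner ℂ (PeriodicBox.planeWave L n σ) f = (((√(L ^ d))⁻¹ : ℝ) : ℂ) *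
      ∫ x, (starRingEnd ℂ) (boxCharacter L n x) * (f x σ) ∂PeriodicBox.cubeMeasure d L := by
  rw [MeasureTheory.L2.inner_def, ← integral_const_mul]
  refine integral_congr_ae ?_
  filter_upwards [(PeriodicBox.memLp_planeWaveFun L n σ).coeFn_toLp] with x hx
  rw [PeriodicBox.planeWave, hx, planeWaveFun_eq, inner_smul_left, EuclideanSpace.inner_single_left]
  simp only [map_mul, map_one, one_mul, Complex.conj_ofReal]
  ring

theorem orthonormal_planeWave (d q : ℕ) {L : ℝ} (hL : 0 < L) :
    Orthonormal ℂ fun p : (Fin d → ℤ) × Fin q =>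
      (PeriodicBox.planeWave L p.1 p.2 : PeriodicBox.BoxL2 d q L) := by
  classical
  have := isProbabilityMeasure_boxProb d hL
  have hχ := isCharacterFamily_boxCharacter d hL
  rw [orthonormal_iff_ite]
  rintro ⟨n, σ⟩ ⟨m, τ⟩
  have hLd : 0 < L ^ d := pow_pos hL d
  have h1 : ∀ᵐ x ∂PeriodicBox.cubeMeasure d L, (starRingEnd ℂ) (boxCharacter L n x) *
      ((PeriodicBox.planeWave L m τ : PeriodicBox.BoxL2 d q L) x σ) =
      (if σ = τ then (((√(L ^ d))⁻¹ : ℝ) : ℂ) else 0) * boxCharacter L (m - n) x := by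
    filter_upwards [(PeriodicBox.memLp_planeWaveFun L m τ).coeFn_toLp] with x hx
    rw [PeriodicBox.planeWave, hx, planeWaveFun_eq, hχ.sub]
    simp only [PiLp.smul_apply, PiLp.single_apply, smul_eq_mul]
    split_ifs <;> ring
  rw [inner_planeWave, integral_congr_ae h1, integral_const_mul, integral_cubeMeasure_eq hL,
    hχ.integral_sub]
  by_cases hn : n = m
  · by_cases hs : σ = τ
    · simp only [hs, hn, if_true, mul_one]
      norm_cast
      rw [← mul_assoc, ← mul_inv, Real.mul_self_sqrt hLd.le, inv_mul_cancel₀ hLd.ne']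
    · simp [hs]
  · simp [hn, Ne.symm hn]

/-- A square-integrable function on the box without Fourier coefficients vanishes. -/
theorem ae_eq_zero_of_integral_boxCharacter {d : ℕ} {L : ℝ} (hL : 0 < L) {f : (Fin d → ℝ) → ℂ}
    (hf : StronglyMeasurable f) (hf2 : MemLp f 2 (boxProb d L))
    (h : ∀ n, ∫ x, (starRingEnd ℂ) (boxCharacter L n x) * f x ∂boxProb d L = 0) :
    f =ᵐ[boxProb d L] 0 := by
  have hmp := measurePreserving_boxToTorus d hL
  set ν := (Measure.pi fun _ : Fin d => (AddCircle.haarAddCircle : Measure UnitAddCircle)) with hν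
  have hcube : ∀ᵐ x ∂boxProb d L, x ∈ PeriodicBox.cube d L := by
    refine Measure.ae_smul_measure ?_ _
    exact ae_restrict_mem (MeasurableSet.univ_pi fun _ => measurableSet_Ico)
  set g : UnitAddTorus (Fin d) → ℂ := f ∘ torusToBox L with hg
  have hgm : StronglyMeasurable g := hf.comp_measurable (measurable_torusToBox L)
  have hgf : g ∘ boxToTorus L =ᵐ[boxProb d L] f := by
    filter_upwards [hcube] with x hx
    simp only [hg, Function.comp_apply, torusToBox_boxToTorus hL hx]
  have hg2 : MemLp g 2 ν := by
    rw [← hmp.map_eq, memLp_map_measure_iff hgm.aestronglyMeasurable hmp.measurable.aemeasurable,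
      memLp_congr_ae hgf]
    exact hf2
  have hcoeff : ∀ n, ∫ t, UnitAddTorus.mFourier (-n) t • g t ∂ν = 0 := by
    intro n
    rw [← hmp.map_eq, integral_map (f := fun t => UnitAddTorus.mFourier (-n) t • g t)
      hmp.measurable.aemeasurable
      ((UnitAddTorus.mFourier (-n)).continuous.stronglyMeasurable.smul hgm).aestronglyMeasurable,
      ← h n]
    refine integral_congr_ae ?_
    filter_upwards [hgf] with x hx
    rw [boxCharacter_eq_mFourier, ← UnitAddTorus.mFourier_neg, ← hx, smul_eq_mul]
    rfl
  have hzero : hg2.toLp g = 0 := by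
    apply (UnitAddTorus.mFourierBasis (d := Fin d)).repr.injective
    ext n
    rw [map_zero]
    refine (UnitAddTorus.mFourierBasis_repr _ n).trans ?_
    refine Eq.trans (integral_congr_ae ?_) (hcoeff n)
    filter_upwards [hg2.coeFn_toLp] with t ht
    rw [ht]
  have hg0 : g =ᵐ[ν] 0 := by
    have := hg2.coeFn_toLp
    rw [hzero] at this
    exact this.symm.trans (Lp.coeFn_zero _ _ _)
  have := hmp.quasiMeasurePreserving.ae hg0
  filter_upwards [this, hgf] with x h1 h2
  rw [← h2]
  exact h1

theorem span_planeWave_orthogonal_eq_bot (d q : ℕ) {L : ℝ} (hL : 0 < L) :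
    (Submodule.span ℂ (Set.range fun p : (Fin d → ℤ) × Fin q =>
      (PeriodicBox.planeWave L p.1 p.2 : PeriodicBox.BoxL2 d q L)))ᗮ = ⊥ := by
  rw [Submodule.eq_bot_iff]
  intro f hf
  have h0 : ∀ n σ, inner ℂ (PeriodicBox.planeWave L n σ) f = 0 := fun n σ =>
    Submodule.inner_right_of_mem_orthogonal
      (Submodule.subset_span (Set.mem_range_self (n, σ))) hf
  have hLd : 0 < L ^ d := pow_pos hL d
  have hc : ENNReal.ofReal L⁻¹ ^ d ≠ 0 :=
    (ENNReal.pow_pos (ENNReal.ofReal_pos.2 (inv_pos.2 hL)) d).ne'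
  have hσ : ∀ σ, (fun x => f x σ) =ᵐ[boxProb d L] 0 := by
    intro σ
    refine ae_eq_zero_of_integral_boxCharacter hL ?_ ?_ fun n => ?_
    · exact (EuclideanSpace.proj (𝕜 := ℂ) σ).continuous.comp_stronglyMeasurable
        (Lp.stronglyMeasurable f)
    · refine MemLp.smul_measure ?_ (ENNReal.pow_ne_top ENNReal.ofReal_ne_top)
      exact (EuclideanSpace.proj (𝕜 := ℂ) σ).comp_memLp' (Lp.memLp f)
    · have h1 := h0 n σ
      rw [inner_planeWave, integral_cubeMeasure_eq hL] at h1
      have hs : (((√(L ^ d))⁻¹ : ℝ) : ℂ) ≠ 0 := by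
        simpa using (Real.sqrt_pos.2 hLd).ne'
      have hs' : ((L ^ d : ℝ) : ℂ) ≠ 0 := by exact_mod_cast hLd.ne'
      exact (mul_eq_zero.1 ((mul_eq_zero.1 h1).resolve_left hs)).resolve_left hs'
  rw [Lp.eq_zero_iff_ae_eq_zero]
  have hσ' : ∀ σ, ∀ᵐ x ∂PeriodicBox.cubeMeasure d L, f x σ = 0 := fun σ =>
    (Measure.ae_ennreal_smul_measure_iff hc).1 (hσ σ)
  filter_upwards [ae_all_iff.2 hσ'] with x hx
  ext σ
  exact hx σ

/-- The plane waves as a Hilbert basis. -/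
def planeWaveBasis (d q : ℕ) {L : ℝ} (hL : 0 < L) :
    HilbertBasis ((Fin d → ℤ) × Fin q) ℂ (PeriodicBox.BoxL2 d q L) :=
  HilbertBasis.mkOfOrthogonalEqBot (orthonormal_planeWave d q hL)
    (span_planeWave_orthogonal_eq_bot d q hL)

theorem planeWaveBasis_apply (d q : ℕ) {L : ℝ} (hL : 0 < L) (p : (Fin d → ℤ) × Fin q) :
    planeWaveBasis d q hL p = PeriodicBox.planeWave L p.1 p.2 := by
  rw [planeWaveBasis, HilbertBasis.coe_mkOfOrthogonalEqBot]

/-! ### The semi-classical energy variation -/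

theorem rpow_variation_le_sq {a r s : ℝ} (ha : 0 < a) (hr : 0 ≤ r) (hs0 : 0 ≤ s) (hs1 : s ≤ 1) :
    (a + r) ^ (1 + s) - a ^ (1 + s) - (1 + s) * a ^ s * r ≤ s * (a ^ s / a * r ^ 2) := by
  have h1 : (a + r) ^ s ≤ a ^ s * (1 + s * (r / a)) := by
    have : a + r = a * (1 + r / a) := by field_simp
    rw [this, Real.mul_rpow ha.le (by positivity)]
    gcongr
    exact rpow_one_add_le_one_add_mul_self (by have : 0 ≤ r / a := by positivity
                                               linarith) hs0 hs1
  rw [Real.rpow_add (by linarith), Real.rpow_add ha, Real.rpow_one, Real.rpow_one]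
  have h2 := mul_le_mul_of_nonneg_left h1 (by linarith : 0 ≤ a + r)
  have h3 : (a + r) * (a ^ s * (1 + s * (r / a))) =
      a * a ^ s + (1 + s) * a ^ s * r + s * (a ^ s / a * r ^ 2) := by
    field_simp
    ring
  linarith

theorem rpow_variation_le_rpow {a r s : ℝ} (ha : 0 < a) (hr : 0 ≤ r) (hs0 : 0 ≤ s) (hs1 : s ≤ 1) :
    (a + r) ^ (1 + s) - a ^ (1 + s) - (1 + s) * a ^ s * r ≤ 4 * r ^ (1 + s) := by
  rcases hr.eq_or_lt with rfl | hr
  · have : (0 : ℝ) ≤ 0 ^ (1 + s) := by positivity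
    simp only [add_zero, mul_zero, sub_self]
    linarith
  have hp : 0 ≤ r ^ (1 + s) := by positivity
  rcases le_total r a with h | h
  · refine (rpow_variation_le_sq ha hr.le hs0 hs1).trans ?_
    have h1 : a ^ s / a ≤ r ^ s / r := by
      rw [← Real.rpow_sub_one ha.ne', ← Real.rpow_sub_one hr.ne']
      exact Real.rpow_le_rpow_of_nonpos hr h (by linarith)
    have h2 : r ^ s / r * r ^ 2 = r ^ (1 + s) := by
      rw [Real.rpow_add hr, Real.rpow_one]
      field_simp
    have h3 : a ^ s / a * r ^ 2 ≤ r ^ (1 + s) := by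
      rw [← h2]
      gcongr
    have h4 : 0 ≤ a ^ s / a * r ^ 2 := by positivity
    nlinarith
  · have h1 : (a + r) ^ (1 + s) ≤ (2 * r) ^ (1 + s) :=
      Real.rpow_le_rpow (by linarith) (by linarith) (by linarith)
    have h2 : (2 * r) ^ (1 + s) ≤ 4 * r ^ (1 + s) := by
      rw [Real.mul_rpow two_pos.le hr.le]
      gcongr
      calc (2 : ℝ) ^ (1 + s) ≤ 2 ^ (2 : ℝ) :=
            Real.rpow_le_rpow_of_exponent_le one_le_two (by linarith)
        _ = 4 := by norm_num
    have h3 : 0 ≤ a ^ (1 + s) := by positivity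
    have h4 : 0 ≤ (1 + s) * a ^ s * r := by positivity
    linarith

theorem sphereArea_pos {d : ℕ} (hd : 2 ≤ d) : 0 < PeriodicBox.sphereArea d := by
  have : NeZero d := ⟨by omega⟩
  have : Nontrivial (EuclideanSpace ℝ (Fin d)) :=
    Module.nontrivial_of_finrank_pos (R := ℝ) (by rw [finrank_euclideanSpace_fin]; omega)
  rw [PeriodicBox.sphereArea, Measure.toSphere_real_apply_univ, finrank_euclideanSpace_fin]
  refine mul_pos (by exact_mod_cast (by omega : 0 < d)) ?_
  rw [measureReal_def]
  exact ENNReal.toReal_pos (Metric.measure_ball_pos _ _ one_pos).ne' measure_ball_lt_top.ne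

/-- The density of the free Fermi gas at unit chemical potential. -/
def unitFermiDensity (d q : ℕ) : ℝ :=
  q * ((2 * Real.pi) ^ d)⁻¹ * PeriodicBox.sphereArea d / d

theorem unitFermiDensity_pos {d q : ℕ} (hd : 2 ≤ d) (hq : 1 ≤ q) : 0 < unitFermiDensity d q := by
  have := sphereArea_pos hd
  have : (0 : ℝ) < d := by exact_mod_cast (by omega : 0 < d)
  have : (0 : ℝ) < q := by exact_mod_cast (by omega : 0 < q)
  have := Real.pi_pos
  unfold unitFermiDensity
  positivity

theorem fermiDensity_eq {d q : ℕ} {μ : ℝ} (hμ : 0 ≤ μ) :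
    PeriodicBox.fermiDensity d q μ = unitFermiDensity d q * √μ ^ d := by
  have h2 : √μ ^ d = μ ^ ((d : ℝ) / 2) := by
    rw [Real.sqrt_eq_rpow, ← Real.rpow_natCast, ← Real.rpow_mul hμ]
    congr 1
    ring
  rw [PeriodicBox.fermiDensity, unitFermiDensity, h2]
  ring

/-- The constant in the comparison of the semi-classical energy variation with the energy
profile. -/
def variationConst (d q : ℕ) : ℝ :=
  4 * max 1 (unitFermiDensity d q ^ (2 / (d : ℝ)) / unitFermiDensity d q)

theorem variationConst_pos (d q : ℕ) : 0 < variationConst d q := by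
  unfold variationConst
  have : 1 ≤ max 1 (unitFermiDensity d q ^ (2 / (d : ℝ)) / unitFermiDensity d q) := le_max_left _ _
  linarith

theorem rpow_one_add_two_div {d : ℕ} (hd : 2 ≤ d) {L t : ℝ} (hL : 0 < L) (ht : 0 ≤ t) :
    (t / L ^ d) ^ (1 + 2 / (d : ℝ)) = (t * t ^ (2 / (d : ℝ))) / L ^ (d + 2) := by
  have hd' : (d : ℝ) ≠ 0 := by exact_mod_cast (by omega : d ≠ 0)
  rw [Real.div_rpow ht (by positivity), Real.rpow_add' ht (by positivity), Real.rpow_one,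
    ← Real.rpow_natCast L d, ← Real.rpow_mul hL.le,
    show (d : ℝ) * (1 + 2 / d) = ((d + 2 : ℕ) : ℝ) by push_cast; field_simp, Real.rpow_natCast]

/-- For a Fermi momentum `√μ ≥ R / L` the energy variation is controlled by the profile. -/
theorem deltaT_le_energyProfile {d q : ℕ} (hd : 2 ≤ d) (hq : 1 ≤ q) {μ L R t : ℝ} (hL : 0 < L)
    (hR : 0 < R) (hRμ : R ≤ √μ * L) (ht : 0 ≤ t) :
    PeriodicBox.deltaT d q μ (t / L ^ d) ≤
      variationConst d q / L ^ (d + 2) * energyProfile d R t := by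
  have hsμ : 0 < √μ := by
    by_contra h
    have : √μ * L ≤ 0 := mul_nonpos_of_nonpos_of_nonneg (not_lt.1 h) hL.le
    linarith
  have hμ : 0 < μ := Real.sqrt_pos.1 hsμ
  have hd' : (2 : ℝ) ≤ d := by exact_mod_cast hd
  have hd0 : (d : ℝ) ≠ 0 := by linarith
  set c := unitFermiDensity d q with hc
  have hc0 : 0 < c := unitFermiDensity_pos hd hq
  set s : ℝ := 2 / d with hs
  have hs0 : 0 ≤ s := by positivity
  have hs1 : s ≤ 1 := by rw [hs, div_le_one (by linarith)]; exact hd'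
  set a := PeriodicBox.fermiDensity d q μ with ha
  have haeq : a = c * √μ ^ d := fermiDensity_eq hμ.le
  have ha0 : 0 < a := by rw [haeq]; positivity
  have hr : 0 ≤ t / L ^ d := by positivity
  have hco : ((d : ℝ) + 2) / d = 1 + s := by rw [hs]; field_simp
  have hBpos : 0 < variationConst d q := variationConst_pos d q
  have hLp : 0 < L ^ (d + 2) := by positivity
  have hB1 : 4 ≤ variationConst d q := by
    unfold variationConst
    linarith [le_max_left 1 (unitFermiDensity d q ^ (2 / (d : ℝ)) / unitFermiDensity d q)]
  have hB2 : c ^ s / c ≤ variationConst d q := by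
    unfold variationConst
    have h1 := le_max_right 1 (unitFermiDensity d q ^ (2 / (d : ℝ)) / unitFermiDensity d q)
    have h2 : 0 ≤ max 1 (unitFermiDensity d q ^ (2 / (d : ℝ)) / unitFermiDensity d q) :=
      zero_le_one.trans (le_max_left _ _)
    linarith
  unfold PeriodicBox.deltaT
  rw [hco]
  have b1 := rpow_variation_le_sq ha0 hr hs0 hs1
  have b2 := rpow_variation_le_rpow ha0 hr hs0 hs1
  rw [hs, rpow_one_add_two_div hd hL ht, ← hs] at b2
  have has : a ^ s / a = (c ^ s / c) / √μ ^ (d - 2) := by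
    have h1 : a ^ s = c ^ s * √μ ^ 2 := by
      rw [haeq, Real.mul_rpow hc0.le (by positivity), ← Real.rpow_natCast √μ d,
        ← Real.rpow_mul hsμ.le, hs, show (d : ℝ) * (2 / d) = (2 : ℕ) by push_cast; field_simp,
        Real.rpow_natCast]
    have h2 : √μ ^ d = √μ ^ (d - 2) * √μ ^ 2 := by rw [← pow_add]; congr 1; omega
    rw [h1, haeq, h2]
    field_simp
  have b3 : s * (a ^ s / a * (t / L ^ d) ^ 2) ≤
      variationConst d q / L ^ (d + 2) * (t * (t / R ^ (d - 2))) := by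
    have h0 : 0 ≤ a ^ s / a * (t / L ^ d) ^ 2 := by positivity
    have h1 : s * (a ^ s / a * (t / L ^ d) ^ 2) ≤ a ^ s / a * (t / L ^ d) ^ 2 := by nlinarith
    refine h1.trans ?_
    have hpow : R ^ (d - 2) ≤ (√μ * L) ^ (d - 2) := pow_le_pow_left₀ hR.le hRμ _
    have hLL : (L ^ d) ^ 2 = L ^ (d + 2) * L ^ (d - 2) := by
      rw [← pow_mul, ← pow_add]; congr 1; omega
    calc a ^ s / a * (t / L ^ d) ^ 2
        = (c ^ s / c) / L ^ (d + 2) * (t * (t / (√μ * L) ^ (d - 2))) := by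
          rw [has, div_pow, hLL, mul_pow]
          field_simp
      _ ≤ _ := by gcongr
  have b4 : 4 * (t * t ^ s / L ^ (d + 2)) ≤ variationConst d q / L ^ (d + 2) * (t * t ^ s) := by
    rw [div_mul_eq_mul_div, ← mul_div_assoc]
    gcongr
  unfold energyProfile
  rcases min_choice (t / R ^ (d - 2)) (t ^ (2 / (d : ℝ))) with h | h
  · rw [h]; exact b1.trans b3
  · rw [h]; exact b2.trans b4

theorem deltaT_zero {d q : ℕ} (hd : 2 ≤ d) (r : ℝ) :
    PeriodicBox.deltaT d q 0 r = r ^ (1 + 2 / (d : ℝ)) := by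
  have hd0 : (d : ℝ) ≠ 0 := by exact_mod_cast (by omega : d ≠ 0)
  have h0 : PeriodicBox.fermiDensity d q 0 = 0 := by
    rw [fermiDensity_eq le_rfl, Real.sqrt_zero, zero_pow (by omega), mul_zero]
  have h1 : (2 / (d : ℝ)) ≠ 0 := by positivity
  have h2 : 1 + 2 / (d : ℝ) ≠ 0 := by positivity
  rw [PeriodicBox.deltaT, h0, Real.zero_rpow h1, Real.zero_rpow h2, zero_add, mul_zero, zero_mul,
    sub_zero, sub_zero]

/-- At low chemical potential, discarding one more particle per box puts the density in the regime
where the profile is a pure power. -/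
theorem deltaT_zero_le_energyProfile {d q : ℕ} (hd : 2 ≤ d) {L t : ℝ} (hL : 0 < L) :
    PeriodicBox.deltaT d q 0 (max (t - 1) 0 / L ^ d) ≤
      variationConst d q / L ^ (d + 2) * energyProfile d 1 (max t 0) := by
  have hd' : (2 : ℝ) ≤ d := by exact_mod_cast hd
  have hB := variationConst_pos d q
  have hB1 : 1 ≤ variationConst d q := by
    unfold variationConst
    linarith [le_max_left 1 (unitFermiDensity d q ^ (2 / (d : ℝ)) / unitFermiDensity d q)]
  have hLp : 0 < L ^ (d + 2) := by positivity
  rw [deltaT_zero hd, rpow_one_add_two_div hd hL (le_max_right _ _)]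
  rcases le_total t 1 with h | h
  · rw [max_eq_right (by linarith : t - 1 ≤ 0), zero_mul, zero_div]
    exact mul_nonneg (by positivity) (energyProfile_nonneg one_pos (le_max_right _ _))
  · have ht0 : 0 ≤ t := by linarith
    rw [max_eq_left (by linarith : 0 ≤ t - 1), max_eq_left ht0, energyProfile, one_pow, div_one]
    have h1 : t ^ (2 / (d : ℝ)) ≤ t := by
      calc t ^ (2 / (d : ℝ)) ≤ t ^ (1 : ℝ) :=
            Real.rpow_le_rpow_of_exponent_le h (by rw [div_le_one (by linarith)]; exact hd')
        _ = t := Real.rpow_one t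
    rw [min_eq_right h1, div_mul_eq_mul_div]
    have h2 : (t - 1) ^ (2 / (d : ℝ)) ≤ t ^ (2 / (d : ℝ)) :=
      Real.rpow_le_rpow (by linarith) (by linarith) (by positivity)
    have h3 : (t - 1) * (t - 1) ^ (2 / (d : ℝ)) ≤ t * t ^ (2 / (d : ℝ)) :=
      mul_le_mul (by linarith) h2 (Real.rpow_nonneg (by linarith) _) ht0
    have h4 : 0 ≤ t * t ^ (2 / (d : ℝ)) := by positivity
    refine div_le_div_of_nonneg_right ?_ hLp.le
    exact h3.trans (le_mul_of_one_le_left h4 hB1)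

/-! ### Truncation to finitely many modes -/

open Filter Topology in
/-- Finitely many families converging in measure converge almost everywhere along a common
sequence. -/
theorem exists_seq_forall_tendsto_ae {α β ι E : Type*} [MeasurableSpace α] {P : Measure α}
    [PseudoEMetricSpace E] {u : Filter β} [u.NeBot] [u.IsCountablyGenerated]
    (f : ι → β → α → E) (g : ι → α → E) (s : Finset ι)
    (h : ∀ i, TendstoInMeasure P (f i) u (g i)) :
    ∃ ns : ℕ → β, Tendsto ns atTop u ∧
      ∀ i ∈ s, ∀ᵐ x ∂P, Tendsto (fun k => f i (ns k) x) atTop (𝓝 (g i x)) := by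
  classical
  induction s using Finset.induction_on with
  | empty =>
    obtain ⟨ns, hns⟩ := exists_seq_tendsto u
    exact ⟨ns, hns, by simp⟩
  | insert a s _ ih =>
    obtain ⟨ns, hns, hs⟩ := ih
    obtain ⟨ms, hms, ha⟩ := ((h a).comp hns).exists_seq_tendsto_ae'
    refine ⟨ns ∘ ms, hns.comp hms, fun i hi => ?_⟩
    rcases Finset.mem_insert.1 hi with rfl | hi
    · exact ha
    · filter_upwards [hs i hi] with x hx
      exact hx.comp hms

section FiniteRank

variable {H : Type*} [NormedAddCommGroup H] [InnerProductSpace ℂ H] [CompleteSpace H]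

/-- The expansion `Q = ∑ |Q bᵢ⟩⟨bᵢ|` of a self-adjoint operator in a basis of its range. -/
theorem sum_inner_mul_inner_of_isSelfAdjoint {Q : H →L[ℂ] H} (hQ : IsSelfAdjoint Q)
    {ι : Type*} [Fintype ι] (b : OrthonormalBasis ι ℂ (LinearMap.range (Q : H →ₗ[ℂ] H))) (v : H) :
    ∑ i, inner ℂ (b i : H) v * inner ℂ v (Q (b i : H)) = inner ℂ v (Q v) := by
  have hsym : ∀ x y : H, inner ℂ (Q x) y = inner ℂ x (Q y) := fun x y => by
    rw [← ContinuousLinearMap.adjoint_inner_left, hQ.adjoint_eq]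
  have h1 : Q v = ∑ i, inner ℂ (b i : H) (Q v) • (b i : H) := by
    have := congrArg (Subtype.val) (b.sum_repr' ⟨Q v, LinearMap.mem_range_self _ v⟩)
    simpa using this.symm
  rw [← hsym v v]
  conv_rhs => rw [h1, sum_inner]
  refine Finset.sum_congr rfl fun i _ => ?_
  rw [inner_smul_left, inner_conj_symm, ← hsym, mul_comm]

end FiniteRank

namespace PeriodicBox

variable {d q : ℕ} {L μ : ℝ}

theorem momentumSq_eq (L : ℝ) (n : Fin d → ℤ) :
    momentumSq L n = (2 * Real.pi / L) ^ 2 * ‖latticePoint n‖ ^ 2 := by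
  rw [momentumSq, norm_latticePoint_sq, Finset.mul_sum]
  refine Finset.sum_congr rfl fun i _ => ?_
  ring

theorem momentumSq_sub (hL : 0 < L) (n : Fin d → ℤ) :
    momentumSq L n - μ =
      (2 * Real.pi / L) ^ 2 * (‖latticePoint n‖ ^ 2 - (L / (2 * Real.pi)) ^ 2 * μ) := by
  have := Real.pi_pos
  rw [momentumSq_eq]
  field_simp

theorem norm_latticePoint_sq_le_iff (hL : 0 < L) (n : Fin d → ℤ) :
    ‖latticePoint n‖ ^ 2 ≤ (L / (2 * Real.pi)) ^ 2 * μ ↔ momentumSq L n ≤ μ := by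
  have := Real.pi_pos
  rw [← not_lt, ← not_lt, ← sub_pos, ← sub_pos (a := momentumSq L n), momentumSq_sub hL,
    mul_pos_iff_of_pos_left (by positivity)]

theorem fermiProj_nonneg : 0 ≤ fermiProj d q L μ :=
  (ContinuousLinearMap.nonneg_iff_isPositive _).2 (ContinuousLinearMap.IsPositive.of_isStarProjection
    isStarProjection_starProjection)

theorem fermiProj_le_one : fermiProj d q L μ ≤ 1 := by
  have := IsStarProjection.le_one (isStarProjection_starProjection (U := fermiSpace d q L μ))
  exact this

theorem fermiProj_planeWave_of_le {n : Fin d → ℤ} (h : momentumSq L n ≤ μ) (σ : Fin q) :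
    fermiProj d q L μ (planeWave L n σ) = planeWave L n σ :=
  Submodule.starProjection_eq_self_iff.2
    (Submodule.le_topologicalClosure _ (Submodule.subset_span ⟨n, σ, h, rfl⟩))

theorem fermiProj_planeWave_of_lt (hL : 0 < L) {n : Fin d → ℤ} (h : μ < momentumSq L n)
    (σ : Fin q) : fermiProj d q L μ (planeWave L n σ) = 0 := by
  rw [fermiProj, Submodule.starProjection_apply_eq_zero_iff, fermiSpace,
    Submodule.orthogonal_closure, Submodule.mem_orthogonal]
  intro u hu
  induction hu using Submodule.span_induction with
  | mem x hx =>
    obtain ⟨m, τ, hm, rfl⟩ := hx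
    refine (orthonormal_planeWave d q hL).2 (i := (m, τ)) (j := (n, σ)) ?_
    rintro ⟨⟩
    exact absurd hm (not_le.2 h)
  | zero => exact inner_zero_left _
  | add x y _ _ hx hy => rw [inner_add_left, hx, hy, add_zero]
  | smul a x _ hx => rw [inner_smul_left, hx, mul_zero]

theorem add_fermiProj_nonneg {Q : BoxL2 d q L →L[ℂ] BoxL2 d q L} (h : -fermiProj d q L μ ≤ Q) :
    0 ≤ Q + fermiProj d q L μ := by
  rw [ContinuousLinearMap.le_def] at h
  rw [ContinuousLinearMap.nonneg_iff_isPositive]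
  rwa [sub_neg_eq_add] at h

theorem add_fermiProj_le_one {Q : BoxL2 d q L →L[ℂ] BoxL2 d q L}
    (h : Q ≤ 1 - fermiProj d q L μ) : Q + fermiProj d q L μ ≤ 1 := by
  rw [ContinuousLinearMap.le_def] at h ⊢
  rwa [sub_sub, add_comm] at h

/-- The orthogonal projection of `f` onto the span of the plane waves with frequencies in `F`. -/
def modeProj (F : Finset (Fin d → ℤ)) (f : BoxL2 d q L) : BoxL2 d q L :=
  ∑ p ∈ F ×ˢ (Finset.univ : Finset (Fin q)),
    inner ℂ (planeWave L p.1 p.2) f • planeWave L p.1 p.2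

open Filter Topology in
theorem tendsto_modeProj (hL : 0 < L) (f : BoxL2 d q L) :
    Tendsto (fun F => modeProj F f) atTop (𝓝 f) := by
  have h := (planeWaveBasis d q hL).hasSum_repr f
  have h2 : Tendsto (fun F : Finset (Fin d → ℤ) => F ×ˢ (Finset.univ : Finset (Fin q)))
      atTop atTop := by
    refine tendsto_atTop_finset_of_monotone (fun F F' hF => Finset.product_subset_product_left hF)
      fun p => ⟨{p.1}, by simp⟩
  refine (h.comp h2).congr fun F => ?_
  simp only [modeProj, Function.comp_apply, HilbertBasis.repr_apply_apply, planeWaveBasis_apply]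

theorem modeProj_ae (F : Finset (Fin d → ℤ)) (f : BoxL2 d q L) :
    ∀ᵐ x ∂cubeMeasure d L, ∀ σ, modeProj F f x σ = (((√(L ^ d))⁻¹ : ℝ) : ℂ) *
      inner ℂ (wavePacket (boxCharacter L)
        (fun p : (Fin d → ℤ) × Fin q => (planeWave L p.1 p.2 : BoxL2 d q L)) F x σ) f := by
  have h1 := Lp.coeFn_finsetSum (F ×ˢ (Finset.univ : Finset (Fin q)))
    fun p => inner ℂ (planeWave L p.1 p.2) f • (planeWave L p.1 p.2 : BoxL2 d q L)
  have h2 : ∀ᵐ x ∂cubeMeasure d L, ∀ p : (Fin d → ℤ) × Fin q,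
      (inner ℂ (planeWave L p.1 p.2) f • (planeWave L p.1 p.2 : BoxL2 d q L) : BoxL2 d q L) x =
        inner ℂ (planeWave L p.1 p.2) f • planeWaveFun L p.1 p.2 x := by
    refine ae_all_iff.2 fun p => ?_
    filter_upwards [Lp.coeFn_smul (inner ℂ (planeWave L p.1 p.2) f)
      (planeWave L p.1 p.2 : BoxL2 d q L), (memLp_planeWaveFun L p.1 p.2).coeFn_toLp] with x hx hx'
    rw [hx, Pi.smul_apply, planeWave, hx']
  filter_upwards [h1, h2] with x hx hx' σ
  rw [modeProj, hx, Finset.sum_apply]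
  simp only [hx']
  rw [WithLp.ofLp_sum, Finset.sum_apply, Finset.sum_product, wavePacket, sum_inner, Finset.mul_sum]
  refine Finset.sum_congr rfl fun n _ => ?_
  simp only [planeWaveFun_eq, PiLp.smul_apply, PiLp.single_apply, smul_eq_mul, inner_smul_left,
    Complex.conj_conj]
  rw [Finset.sum_eq_single σ]
  · rw [if_pos rfl]
    ring
  · intro τ _ hτ
    simp [Ne.symm hτ]
  · simp

/-- The density computed with truncated functions is the density of the truncated operator. -/
theorem sum_inner_modeProj_ae (hL : 0 < L) {Q : BoxL2 d q L →L[ℂ] BoxL2 d q L}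
    (hQ : IsSelfAdjoint Q) {ι : Type*} [Fintype ι]
    (b : OrthonormalBasis ι ℂ (LinearMap.range (Q : BoxL2 d q L →ₗ[ℂ] BoxL2 d q L)))
    (F : Finset (Fin d → ℤ)) :
    ∀ᵐ x ∂cubeMeasure d L,
      ∑ i, (inner ℂ (modeProj F (b i : BoxL2 d q L) x) (modeProj F (Q (b i)) x)).re =
        (L ^ d)⁻¹ * (localDensity (boxCharacter L)
          (fun p : (Fin d → ℤ) × Fin q => (planeWave L p.1 p.2 : BoxL2 d q L)) Q F F x).re := by
  have h1 : ∀ᵐ x ∂cubeMeasure d L, ∀ i, _ := ae_all_iff.2 fun i => modeProj_ae F (b i : BoxL2 d q L)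
  have h2 : ∀ᵐ x ∂cubeMeasure d L, ∀ i, _ := ae_all_iff.2 fun i => modeProj_ae F (Q (b i))
  filter_upwards [h1, h2] with x hx hx'
  have hs : (((√(L ^ d))⁻¹ : ℝ) : ℂ) * (((√(L ^ d))⁻¹ : ℝ) : ℂ) = (((L ^ d)⁻¹ : ℝ) : ℂ) := by
    norm_cast
    rw [← mul_inv, Real.mul_self_sqrt (by positivity)]
  rw [← Complex.re_ofReal_mul, ← Complex.re_sum, localDensity, Finset.mul_sum]
  simp only [PiLp.inner_apply, hx, hx', RCLike.inner_apply, map_mul, Complex.conj_ofReal,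
    inner_conj_symm]
  rw [Finset.sum_comm]
  congr 1
  refine Finset.sum_congr rfl fun σ _ => ?_
  rw [← sum_inner_mul_inner_of_isSelfAdjoint hQ b, Finset.mul_sum, ← hs]
  refine Finset.sum_congr rfl fun i _ => ?_
  ring

open Filter Topology in
/-- Along a sequence of truncations the density converges almost everywhere. -/
theorem exists_seq_tendsto_density (hL : 0 < L) {Q : BoxL2 d q L →L[ℂ] BoxL2 d q L}
    [FiniteDimensional ℂ (LinearMap.range (Q : BoxL2 d q L →ₗ[ℂ] BoxL2 d q L))]
    (hQ : IsSelfAdjoint Q) :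
    ∃ F : ℕ → Finset (Fin d → ℤ), ∀ᵐ x ∂cubeMeasure d L, Tendsto (fun k =>
      (localDensity (boxCharacter L)
        (fun p : (Fin d → ℤ) × Fin q => (planeWave L p.1 p.2 : BoxL2 d q L)) Q (F k) (F k) x).re)
      atTop (𝓝 (L ^ d * density Q x)) := by
  set b := stdOrthonormalBasis ℂ (LinearMap.range (Q : BoxL2 d q L →ₗ[ℂ] BoxL2 d q L)) with hb
  -- The density involves the functions `bᵢ` and `Q bᵢ`; a common sequence is needed for all of them.
  set f : _ ⊕ _ → BoxL2 d q L :=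
    Sum.elim (fun i => (b i : BoxL2 d q L)) fun i => Q (b i : BoxL2 d q L) with hf
  obtain ⟨F, -, hF⟩ := exists_seq_forall_tendsto_ae (P := cubeMeasure d L) (u := atTop)
    (fun i (F : Finset (Fin d → ℤ)) x => modeProj F (f i) x) (fun i x => f i x) Finset.univ
    fun i => tendstoInMeasure_of_tendsto_Lp (tendsto_modeProj hL (f i))
  refine ⟨F, ?_⟩
  have hF' : ∀ᵐ x ∂cubeMeasure d L, ∀ i,
      Tendsto (fun k => modeProj (F k) (f i) x) atTop (𝓝 (f i x)) :=
    ae_all_iff.2 fun i => hF i (Finset.mem_univ i)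
  have h2 : ∀ᵐ x ∂cubeMeasure d L, ∀ k, _ :=
    ae_all_iff.2 fun k => sum_inner_modeProj_ae hL hQ b (F k)
  filter_upwards [hF', h2] with x hx hx2
  have h3 : Tendsto (fun k => L ^ d * ∑ i, (inner ℂ (modeProj (F k) (b i : BoxL2 d q L) x)
      (modeProj (F k) (Q (b i)) x)).re) atTop (𝓝 (L ^ d * density Q x)) := by
    refine Tendsto.const_mul _ (tendsto_finsetSum _ fun i _ => ?_)
    exact (Complex.continuous_re.tendsto _).comp ((hx (Sum.inl i)).inner (hx (Sum.inr i)))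
  refine h3.congr fun k => ?_
  rw [hx2 k, mul_inv_cancel_left₀ (pow_pos hL d).ne']

/-- No mode contributes negatively to the trace. -/
theorem energy_term_nonneg (hL : 0 < L) {Q : BoxL2 d q L →L[ℂ] BoxL2 d q L}
    (h : -fermiProj d q L μ ≤ Q) (h' : Q ≤ 1 - fermiProj d q L μ) (p : (Fin d → ℤ) × Fin q) :
    0 ≤ (momentumSq L p.1 - μ) *
      (inner ℂ (planeWave L p.1 p.2) (Q (planeWave L p.1 p.2))).re := by
  have h1 := re_inner_apply_nonneg (add_fermiProj_nonneg h) (planeWave L p.1 p.2)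
  have h2 := re_inner_apply_le (add_fermiProj_le_one h') (planeWave L p.1 p.2)
  have hn : ‖(planeWave L p.1 p.2 : BoxL2 d q L)‖ = 1 := (orthonormal_planeWave d q hL).1 p
  rw [add_apply, inner_add_right, Complex.add_re] at h1 h2
  rcases le_or_gt (momentumSq L p.1) μ with hp | hp
  -- Below the Fermi level `Q = γ - 1` has nonpositive diagonal, above it `Q = γ` has a nonnegative
  -- one, where `γ = Q + Π⁻`.
  · rw [fermiProj_planeWave_of_le hp, inner_self_eq_norm_sq_to_K, hn] at h2
    simp only [map_one, one_pow, Complex.one_re] at h2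
    exact mul_nonneg_of_nonpos_of_nonpos (by linarith) (by simpa using h2)
  · rw [fermiProj_planeWave_of_lt hL hp, inner_zero_right, Complex.zero_re, add_zero] at h1
    exact mul_nonneg (by linarith) h1

theorem kineticTrace_eq (hL : 0 < L) {Q : BoxL2 d q L →L[ℂ] BoxL2 d q L}
    (h : -fermiProj d q L μ ≤ Q) (h' : Q ≤ 1 - fermiProj d q L μ) :
    kineticTrace μ Q = ((∑' p : (Fin d → ℤ) × Fin q, ENNReal.ofReal
      ((momentumSq L p.1 - μ) * (inner ℂ (planeWave L p.1 p.2) (Q (planeWave L p.1 p.2))).re) :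
        ENNReal) : EReal) := by
  have h0 : ∀ p : (Fin d → ℤ) × Fin q, ENNReal.ofReal (-((momentumSq L p.1 - μ) *
      (inner ℂ (planeWave L p.1 p.2) (Q (planeWave L p.1 p.2))).re)) = 0 := fun p =>
    ENNReal.ofReal_of_nonpos (neg_nonpos.2 (energy_term_nonneg hL h h' p))
  rw [kineticTrace]
  simp only [h0, tsum_zero, EReal.coe_ennreal_zero, sub_zero]

open Filter Topology in
/-- The kinetic energy inequality in the rescaled variables, where the box has volume one and the
momenta are integers. -/
theorem lintegral_energyProfile_le_kineticTrace (hd : 2 ≤ d) (hL : 0 < L) (hμ : 0 ≤ μ)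
    {Q : BoxL2 d q L →L[ℂ] BoxL2 d q L}
    [FiniteDimensional ℂ (LinearMap.range (Q : BoxL2 d q L →ₗ[ℂ] BoxL2 d q L))]
    (hQ : IsSelfAdjoint Q) (h : -fermiProj d q L μ ≤ Q) (h' : Q ≤ 1 - fermiProj d q L μ) :
    ((∫⁻ x, ENNReal.ofReal (energyProfile d (max 1 √((L / (2 * Real.pi)) ^ 2 * μ))
      (max (|L ^ d * density Q x| -
        densitySlack d q * max 1 √((L / (2 * Real.pi)) ^ 2 * μ) ^ (d - 1)) 0)) ∂boxProb d L :
        ENNReal) : EReal) ≤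
      (ENNReal.ofReal (energyConst d q * (L / (2 * Real.pi)) ^ 2) : EReal) * kineticTrace μ Q := by
  have := isProbabilityMeasure_boxProb d hL
  have hpi := Real.pi_pos
  have hχ := isCharacterFamily_boxCharacter d hL
  set e : (Fin d → ℤ) × Fin q → BoxL2 d q L := fun p => planeWave L p.1 p.2 with he
  set M := (L / (2 * Real.pi)) ^ 2 * μ with hM
  set R := max 1 √M with hR
  have hE := energyConst_pos (q := q) hd
  rw [kineticTrace_eq hL h h', ← EReal.coe_ennreal_mul, EReal.coe_ennreal_le_coe_ennreal_iff]
  set T := ∑' p : (Fin d → ℤ) × Fin q, ENNReal.ofReal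
      ((momentumSq L p.1 - μ) * (inner ℂ (planeWave L p.1 p.2) (Q (planeWave L p.1 p.2))).re)
    with hT
  have key : ∀ F : Finset (Fin d → ℤ), ∫⁻ x, ENNReal.ofReal (energyProfile d R
      (max (|(localDensity (boxCharacter L) e Q F F x).re| - densitySlack d q * R ^ (d - 1)) 0))
        ∂boxProb d L ≤ ENNReal.ofReal (energyConst d q * (L / (2 * Real.pi)) ^ 2) * T := by
    intro F
    have h1 := lintegral_energyProfile_density_le hd hχ (orthonormal_planeWave d q hL)
      (M := M) (by positivity) (add_fermiProj_nonneg h) (add_fermiProj_le_one h')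
      fermiProj_nonneg fermiProj_le_one
      (fun n σ hn => fermiProj_planeWave_of_le ((norm_latticePoint_sq_le_iff hL n).1 hn) σ)
      (fun n σ hn => fermiProj_planeWave_of_lt hL
        (not_le.1 fun hc => not_le.2 hn ((norm_latticePoint_sq_le_iff hL n).2 hc)) σ) F
    rw [add_sub_cancel_right] at h1
    refine h1.trans ?_
    have h2 : energyConst d q * ∑ n ∈ F, (‖latticePoint n‖ ^ 2 - M) *
        ∑ σ, (inner ℂ (e (n, σ)) (Q (e (n, σ)))).re =
        energyConst d q * (L / (2 * Real.pi)) ^ 2 *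
          ∑ p ∈ F ×ˢ (Finset.univ : Finset (Fin q)), (momentumSq L p.1 - μ) *
            (inner ℂ (planeWave L p.1 p.2) (Q (planeWave L p.1 p.2))).re := by
      rw [mul_assoc]
      congr 1
      rw [Finset.sum_product, Finset.mul_sum]
      refine Finset.sum_congr rfl fun n _ => ?_
      dsimp only [e]
      rw [← Finset.mul_sum, momentumSq_sub hL, ← mul_assoc, ← mul_assoc,
        ← mul_pow, show L / (2 * Real.pi) * (2 * Real.pi / L) = 1 by field_simp, one_pow, one_mul]
    rw [h2, ENNReal.ofReal_mul (by positivity),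
      ENNReal.ofReal_sum_of_nonneg fun p _ => energy_term_nonneg hL h h' p]
    gcongr
    exact ENNReal.sum_le_tsum _
  obtain ⟨F, hF⟩ := exists_seq_tendsto_density hL hQ
  have hcont : Continuous fun r : ℝ => ENNReal.ofReal (energyProfile d R
      (max (|r| - densitySlack d q * R ^ (d - 1)) 0)) := by
    refine ENNReal.continuous_ofReal.comp (continuous_energyProfile.comp ?_)
    fun_prop
  have hmeas : ∀ k, Measurable fun x => ENNReal.ofReal (energyProfile d R
      (max (|(localDensity (boxCharacter L) e Q (F k) (F k) x).re| -
        densitySlack d q * R ^ (d - 1)) 0)) := fun k =>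
    hcont.measurable.comp (Complex.measurable_re.comp (measurable_localDensity hχ Q (F k) (F k)))
  -- Fatou's lemma along a sequence of truncations.
  calc ∫⁻ x, ENNReal.ofReal (energyProfile d R
        (max (|L ^ d * density Q x| - densitySlack d q * R ^ (d - 1)) 0)) ∂boxProb d L
      = ∫⁻ x, liminf (fun k => ENNReal.ofReal (energyProfile d R
        (max (|(localDensity (boxCharacter L) e Q (F k) (F k) x).re| -
          densitySlack d q * R ^ (d - 1)) 0))) atTop ∂boxProb d L := by
        refine lintegral_congr_ae ?_
        filter_upwards [Measure.ae_smul_measure hF _] with x hx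
        exact ((hcont.tendsto _).comp hx).liminf_eq.symm
    _ ≤ liminf (fun k => ∫⁻ x, ENNReal.ofReal (energyProfile d R
        (max (|(localDensity (boxCharacter L) e Q (F k) (F k) x).re| -
          densitySlack d q * R ^ (d - 1)) 0)) ∂boxProb d L) atTop := lintegral_liminf_le hmeas
    _ ≤ _ := liminf_le_of_le (by isBoundedDefault) fun b hb => by
        obtain ⟨k, hk⟩ := hb.exists
        exact hk.trans (key (F k))

end PeriodicBox

/-! ### The kinetic energy inequality -/

namespace PeriodicBox

variable {d q : ℕ} {L μ : ℝ}

theorem lintegral_cubeMeasure_eq (hL : 0 < L) (f : (Fin d → ℝ) → ENNReal) :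
    ∫⁻ x, f x ∂cubeMeasure d L = ENNReal.ofReal (L ^ d) * ∫⁻ x, f x ∂boxProb d L := by
  rw [boxProb, lintegral_smul_measure, smul_eq_mul, ← mul_assoc,
    ← ENNReal.ofReal_pow (inv_pos.2 hL).le, ← ENNReal.ofReal_mul (by positivity), inv_pow,
    mul_inv_cancel₀ (pow_pos hL d).ne', ENNReal.ofReal_one, one_mul]

/-- The prefactor of the semi-classical energy in the kinetic energy inequality. -/
def kineticConst (d q : ℕ) : ℝ := 4 * Real.pi ^ 2 / (variationConst d q * energyConst d q)

theorem kineticConst_pos (hd : 2 ≤ d) : 0 < kineticConst d q := by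
  have := variationConst_pos d q
  have := energyConst_pos (q := q) hd
  have := Real.pi_pos
  unfold kineticConst
  positivity

/-- Undoing the rescaling: a function controlled by the energy profile of the density is
controlled, after integration over the box, by the trace. -/
theorem lintegral_le_kineticTrace_of_le (hd : 2 ≤ d) (hL : 0 < L) (hμ : 0 ≤ μ)
    {Q : BoxL2 d q L →L[ℂ] BoxL2 d q L}
    [FiniteDimensional ℂ (LinearMap.range (Q : BoxL2 d q L →ₗ[ℂ] BoxL2 d q L))]
    (hQ : IsSelfAdjoint Q) (h : -fermiProj d q L μ ≤ Q) (h' : Q ≤ 1 - fermiProj d q L μ)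
    {g : (Fin d → ℝ) → ℝ}
    (hg : ∀ x, g x ≤ variationConst d q / L ^ (d + 2) *
      energyProfile d (max 1 √((L / (2 * Real.pi)) ^ 2 * μ)) (max (|L ^ d * density Q x| -
        densitySlack d q * max 1 √((L / (2 * Real.pi)) ^ 2 * μ) ^ (d - 1)) 0)) :
    ((ENNReal.ofReal (kineticConst d q) * ∫⁻ x in cube d L, ENNReal.ofReal (g x) : ENNReal) :
      EReal) ≤ kineticTrace μ Q := by
  have hB := variationConst_pos d q
  have hE := energyConst_pos (q := q) hd
  have hK := kineticConst_pos (q := q) hd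
  have hpi := Real.pi_pos
  have key := lintegral_energyProfile_le_kineticTrace hd hL hμ hQ h h'
  rw [kineticTrace_eq hL h h', ← EReal.coe_ennreal_mul, EReal.coe_ennreal_le_coe_ennreal_iff] at key
  rw [kineticTrace_eq hL h h', EReal.coe_ennreal_le_coe_ennreal_iff]
  set T := ∑' p : (Fin d → ℤ) × Fin q, ENNReal.ofReal
      ((momentumSq L p.1 - μ) * (inner ℂ (planeWave L p.1 p.2) (Q (planeWave L p.1 p.2))).re)
  set f : (Fin d → ℝ) → ℝ := fun x => energyProfile d (max 1 √((L / (2 * Real.pi)) ^ 2 * μ))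
    (max (|L ^ d * density Q x| -
      densitySlack d q * max 1 √((L / (2 * Real.pi)) ^ 2 * μ) ^ (d - 1)) 0)
  have hconst : kineticConst d q * (variationConst d q / L ^ (d + 2) * (L ^ d *
      (energyConst d q * (L / (2 * Real.pi)) ^ 2))) = 1 := by
    unfold kineticConst
    rw [pow_add]
    field_simp
    norm_num
  calc ENNReal.ofReal (kineticConst d q) * ∫⁻ x in cube d L, ENNReal.ofReal (g x)
      ≤ ENNReal.ofReal (kineticConst d q) * ∫⁻ x in cube d L,
          ENNReal.ofReal (variationConst d q / L ^ (d + 2)) * ENNReal.ofReal (f x) := by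
        gcongr with x
        rw [← ENNReal.ofReal_mul (by positivity)]
        exact ENNReal.ofReal_le_ofReal (hg x)
    _ = ENNReal.ofReal (kineticConst d q) * (ENNReal.ofReal (variationConst d q / L ^ (d + 2)) *
          (ENNReal.ofReal (L ^ d) * ∫⁻ x, ENNReal.ofReal (f x) ∂boxProb d L)) := by
        rw [lintegral_const_mul' _ _ ENNReal.ofReal_ne_top, ← lintegral_cubeMeasure_eq hL]
    _ ≤ ENNReal.ofReal (kineticConst d q) * (ENNReal.ofReal (variationConst d q / L ^ (d + 2)) *
          (ENNReal.ofReal (L ^ d) *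
            (ENNReal.ofReal (energyConst d q * (L / (2 * Real.pi)) ^ 2) * T))) := by gcongr
    _ = T := by
        rw [← mul_assoc (ENNReal.ofReal (L ^ d)), ← ENNReal.ofReal_mul (by positivity),
          ← mul_assoc (ENNReal.ofReal (_ / _)), ← ENNReal.ofReal_mul (by positivity),
          ← mul_assoc, ← ENNReal.ofReal_mul hK.le, hconst, ENNReal.ofReal_one, one_mul]

theorem sqrt_rescaled (hL : 0 < L) : √((L / (2 * Real.pi)) ^ 2 * μ) = √μ * L / (2 * Real.pi) := by
  have := Real.pi_pos
  rw [Real.sqrt_mul (by positivity), Real.sqrt_sq (by positivity)]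
  ring

theorem rpow_half_mul_pow (hd : 2 ≤ d) (hμ : 0 ≤ μ) (hL : 0 < L) :
    L ^ d * (L⁻¹ * μ ^ (((d : ℝ) - 1) / 2)) = (√μ * L) ^ (d - 1) := by
  have h1 : μ ^ (((d : ℝ) - 1) / 2) = √μ ^ (d - 1) := by
    rw [Real.sqrt_eq_rpow, ← Real.rpow_natCast, ← Real.rpow_mul hμ, Nat.cast_sub (by omega)]
    congr 1
    push_cast
    ring
  have h2 : L ^ d = L ^ (d - 1) * L := by rw [← pow_succ]; congr 1; omega
  rw [h1, h2, mul_pow]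
  field_simp

theorem deltaT_density_le_of_lt (hd : 2 ≤ d) (hq : 1 ≤ q) (hL : 0 < L) (hμ : 1 / L ^ 2 < μ)
    (ρ : ℝ) :
    deltaT d q μ (max (|ρ| - (densitySlack d q + 1) * L⁻¹ * μ ^ (((d : ℝ) - 1) / 2)) 0) ≤
      variationConst d q / L ^ (d + 2) *
        energyProfile d (max 1 √((L / (2 * Real.pi)) ^ 2 * μ)) (max (|L ^ d * ρ| -
          densitySlack d q * max 1 √((L / (2 * Real.pi)) ^ 2 * μ) ^ (d - 1)) 0) := by
  have hLd : 0 < L ^ d := pow_pos hL d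
  have hμ0 : 0 ≤ μ := (by positivity : (0 : ℝ) ≤ 1 / L ^ 2).trans hμ.le
  have hS := densitySlack_nonneg (q := q) hd
  have h1 : 1 ≤ √μ * L := by
    have h : 1 / L ≤ √μ := by
      refine Real.le_sqrt_of_sq_le ?_
      rw [div_pow, one_pow]
      exact hμ.le
    rwa [div_le_iff₀ hL] at h
  set R := max 1 √((L / (2 * Real.pi)) ^ 2 * μ) with hR
  have hR1 : 1 ≤ R := le_max_left _ _
  have hRμ : R ≤ √μ * L := by
    rw [hR, sqrt_rescaled hL]
    refine max_le h1 (div_le_self (by linarith) ?_)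
    linarith [Real.pi_gt_three]
  set s := (densitySlack d q + 1) * L⁻¹ * μ ^ (((d : ℝ) - 1) / 2) with hs
  have ht : 0 ≤ L ^ d * max (|ρ| - s) 0 := by positivity
  have hB := variationConst_pos d q
  have key := deltaT_le_energyProfile hd hq hL (by linarith) hRμ ht
  rw [mul_div_cancel_left₀ _ hLd.ne'] at key
  refine key.trans (mul_le_mul_of_nonneg_left (energyProfile_mono (by linarith) ht ?_)
    (by positivity))
  have hs2 : densitySlack d q * R ^ (d - 1) ≤ L ^ d * s := by
    have e : L ^ d * s = (densitySlack d q + 1) * (√μ * L) ^ (d - 1) := by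
      rw [← rpow_half_mul_pow hd hμ0 hL, hs]
      ring
    rw [e]
    gcongr
    linarith
  rw [mul_max_of_nonneg _ _ hLd.le, mul_zero, mul_sub, abs_mul, abs_of_pos hLd]
  exact max_le_max (by linarith) le_rfl

theorem deltaT_density_le_of_le (hd : 2 ≤ d) (hL : 0 < L) (hμ : μ ≤ 1 / L ^ 2) (ρ : ℝ) :
    deltaT d q 0 (max (|ρ| - (densitySlack d q + 1) * (L ^ d)⁻¹) 0) ≤
      variationConst d q / L ^ (d + 2) *
        energyProfile d (max 1 √((L / (2 * Real.pi)) ^ 2 * μ)) (max (|L ^ d * ρ| -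
          densitySlack d q * max 1 √((L / (2 * Real.pi)) ^ 2 * μ) ^ (d - 1)) 0) := by
  have hLd : 0 < L ^ d := pow_pos hL d
  have h1 : √μ * L ≤ 1 := by
    have h : √μ ≤ 1 / L := by
      refine Real.sqrt_le_iff.2 ⟨by positivity, ?_⟩
      rw [div_pow, one_pow]
      exact hμ
    rwa [le_div_iff₀ hL] at h
  have hR : max 1 √((L / (2 * Real.pi)) ^ 2 * μ) = 1 := by
    rw [sqrt_rescaled hL]
    refine max_eq_left ((div_le_one (by positivity)).2 ?_)
    linarith [Real.pi_gt_three]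
  rw [hR, one_pow, mul_one]
  have key := deltaT_zero_le_energyProfile (q := q) hd (t := |L ^ d * ρ| - densitySlack d q) hL
  convert key using 2
  rw [eq_div_iff hLd.ne', max_mul_of_nonneg _ _ hLd.le, zero_mul, sub_mul,
    inv_mul_cancel_right₀ hLd.ne', abs_mul, abs_of_pos hLd]
  congr 1
  ring

end PeriodicBox

end

theorem theorem7 (d q : ℕ) (hd : 2 ≤ d) (hq : 1 ≤ q) :
    ∃ K C : ℝ, 0 < K ∧ 0 < C ∧
      ∀ (μ L : ℝ), 0 ≤ μ → 0 < L →
      ∀ (Q : PeriodicBox.BoxL2 d q L →L[ℂ] PeriodicBox.BoxL2 d q L)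
        [FiniteDimensional ℂ
          (LinearMap.range (Q : PeriodicBox.BoxL2 d q L →ₗ[ℂ] PeriodicBox.BoxL2 d q L))],
        IsSelfAdjoint Q →
        -PeriodicBox.fermiProj d q L μ ≤ Q →
        Q ≤ 1 - PeriodicBox.fermiProj d q L μ →
        (1 / L ^ 2 < μ →
          ((ENNReal.ofReal K * ∫⁻ x in PeriodicBox.cube d L, ENNReal.ofReal
              (PeriodicBox.deltaT d q μ
                (max (|PeriodicBox.density Q x| - C * L⁻¹ * μ ^ (((d : ℝ) - 1) / 2)) 0)) :
            ENNReal) : EReal) ≤ PeriodicBox.kineticTrace μ Q) ∧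
        (μ ≤ 1 / L ^ 2 →
          ((ENNReal.ofReal K * ∫⁻ x in PeriodicBox.cube d L, ENNReal.ofReal
              (PeriodicBox.deltaT d q 0
                (max (|PeriodicBox.density Q x| - C * (L ^ d)⁻¹) 0)) :
            ENNReal) : EReal) ≤ PeriodicBox.kineticTrace μ Q) := by
  refine ⟨PeriodicBox.kineticConst d q, densitySlack d q + 1, PeriodicBox.kineticConst_pos hd,
    by linarith [densitySlack_nonneg (q := q) hd], fun μ L hμ hL Q _ hQ h h' => ⟨fun hlt => ?_,
    fun hle => ?_⟩⟩
  · exact PeriodicBox.lintegral_le_kineticTrace_of_le hd hL hμ hQ h h' fun x =>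
      PeriodicBox.deltaT_density_le_of_lt hd hq hL hlt _
  · exact PeriodicBox.lintegral_le_kineticTrace_of_le hd hL hμ hQ h h' fun x =>
      PeriodicBox.deltaT_density_le_of_le hd hL hle _
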